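/- Let $\mathbb{D}=\{z\in\mathbb{C}:|z|<1\}$, let $\mathcal{A}$ be the class of analytic functions $f$ in $\mathbb{D}$ with $f(0)=0$ and $f'(0)=1$, and let $\mathcal{S}$ be the class of univalent functions in $\mathcal{A}$. For $0\le\alpha<1$ let $\mathcal{C}(\alpha)$ be the class of $f\in\mathcal{S}$ with $\operatorname{Re}\bigl(1+zf''(z)/f'(z)\bigr)>\alpha$ for all $z\in\mathbb{D}$ (convex functions of order $\alpha$). Let $\mathcal{UCV}$ be the class of $f\in\mathcal{S}$ such that for every circular arc $\gamma\subset\mathbb{D}$ with centre $\zeta\in\mathbb{D}$ the image $f(\gamma)$ is a convex arc, that is, when $\gamma$ is traversed counterclockwise the tangent vector of $f(\gamma)$ is nonzero and has a continuous nondecreasing argument (uniformly convex functions). Let $\mathcal{F}_6$ be the class of $f\in\mathcal{A}$ for which there is $g\in\mathcal{S}$ with $$\left|\frac{f'(z)}{g'(z)}-1\right|<1\qquad(z\in\mathbb{D}).$$ For $\mathcal{G}\subseteq\mathcal{A}$, the (sharp) $\mathcal{G}$-radius of $\mathcal{F}_6$ is the largest $R\le 1$ such that $r^{-1}f(rz)\in\mathcal{G}$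 for all $0<r\le R$ and all $f\in\mathcal{F}_6$. **Theorem.** (a) For every $0\le\alpha<1$, the $\mathcal{C}(\alpha)$-radius of $\mathcal{F}_6$ is $$R_{\mathcal{C}(\alpha)}=\frac{2(1-\alpha)}{5+\sqrt{25+4\alpha(\alpha-1)}}.$$ (b) The $\mathcal{UCV}$-radius of $\mathcal{F}_6$ equals its $\mathcal{C}(1/2)$-radius: $$R_{\mathcal{UCV}}=R_{\mathcal{C}(1/2)}=5-2\sqrt{6}\approx 0.101021$$ (to six decimal places). Moreover, both results are attained by one function: let $f_0\in\mathcal{A}$ be the function with $f_0'(z)=(1+z)^2/(1-z)^3$, and let $g_0(z)=z/(1-z)^2$ be the Koebe function. Then $g_0\in\mathcal{S}$ and $|f_0'(z)/g_0'(z)-1|<1$ in $\mathbb{D}$, so $f_0\in\mathcal{F}_6$. For every $0\le\alpha<1$, $\operatorname{Re}\bigl(1+zf_0''(z)/f_0'(z)\bigr)=\alpha$ at $z=-R_{\mathcal{C}(\alpha)}$, and $r^{-1}f_0(rz)\notin\mathcal{C}(\alpha)$ for $R_{\mathcal{C}(\alpha)}<r\le1$. Finally $|zf_0''(z)/f_0'(z)|=\operatorname{Re}\bigl(1+zf_0''(z)/f_0'(z)\bigr)$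 at $z=-R_{\mathcal{UCV}}$, and $r^{-1}f_0(rz)\notin\mathcal{UCV}$ for $R_{\mathcal{UCV}}<r\le1$. -/

import Mathlib

namespace UnivalentRadius

/-- The open unit disk `𝔻`. -/
def unitDisk : Set ℂ := Metric.ball (0 : ℂ) 1

/-- The class `𝒜` of functions analytic in the unit disk with `f 0 = 0` and `f' 0 = 1`. Functions
are total on `ℂ`, but only their values on the disk are ever used. -/
def classA : Set (ℂ → ℂ) :=
  {f | DifferentiableOn ℂ f unitDisk ∧ f 0 = 0 ∧ deriv f 0 = 1}

/-- The class `𝒮` of univalent functions in `𝒜`. -/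
def classS : Set (ℂ → ℂ) :=
  {f | f ∈ classA ∧ Set.InjOn f unitDisk}

/-- The quantity `z f''(z) / f'(z)`. -/
noncomputable def preSchwarz (f : ℂ → ℂ) (z : ℂ) : ℂ := z * deriv (deriv f) z / deriv f z

/-- The class `𝒞(α)` of convex functions of order `α`: univalent functions in `𝒜` with
`Re (1 + z f''(z) / f'(z)) > α` in the disk. -/
def classC (α : ℝ) : Set (ℂ → ℂ) :=
  {f | f ∈ classS ∧ ∀ z ∈ unitDisk, α < (1 + preSchwarz f z).re}

/-- A parametrized arc `c : [a, b] → ℂ` is a convex arc: its tangent vector never vanishes and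
has a continuous argument `θ` that is nondecreasing along the arc. -/
def IsConvexArc (c : ℝ → ℂ) (a b : ℝ) : Prop :=
  ∃ θ : ℝ → ℝ, ContinuousOn θ (Set.Icc a b) ∧ MonotoneOn θ (Set.Icc a b) ∧
    ∀ t ∈ Set.Icc a b, deriv c t ≠ 0 ∧
      deriv c t = (‖deriv c t‖ : ℂ) * Complex.exp (Complex.I * (θ t : ℂ))

/-- The counterclockwise parametrization `t ↦ ζ + ρ e^{it}` of the circle with centre `ζ` and
radius `ρ`. -/
noncomputable def circleParam (ζ : ℂ) (ρ : ℝ) (t : ℝ) : ℂ :=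
  ζ + (ρ : ℂ) * Complex.exp (Complex.I * (t : ℂ))

/-- The class `𝒰𝒞𝒱` of uniformly convex functions: `f ∈ 𝒮`, and `f` maps every circular arc that
lies in the disk and whose centre lies in the disk onto a convex arc. -/
def classUCV : Set (ℂ → ℂ) :=
  {f | f ∈ classS ∧ ∀ ζ ∈ unitDisk, ∀ ρ a b : ℝ, 0 < ρ → a < b → b ≤ a + 2 * Real.pi →
    (∀ t ∈ Set.Icc a b, circleParam ζ ρ t ∈ unitDisk) →
    IsConvexArc (fun t => f (circleParam ζ ρ t)) a b}

/-- The class `ℱ₆`: functions `f ∈ 𝒜` with `|f'(z) / g'(z) - 1| < 1` in the disk for some univalent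
`g ∈ 𝒜`. -/
def classF6 : Set (ℂ → ℂ) :=
  {f | f ∈ classA ∧ ∃ g ∈ classS, ∀ z ∈ unitDisk, ‖deriv f z / deriv g z - 1‖ < 1}

/-- The dilation `z ↦ r⁻¹ f(rz)`. -/
noncomputable def dilation (r : ℝ) (f : ℂ → ℂ) (z : ℂ) : ℂ := (r : ℂ)⁻¹ * f ((r : ℂ) * z)

/-- `R` is the (sharp) `G`-radius of `F`: the largest `R` such that `r⁻¹ f(rz)` belongs to `G` for
all `0 < r ≤ R` and all `f ∈ F`. Here `R ≤ 1`, since functions in `F` live on the unit disk. -/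
def IsRadius (G F : Set (ℂ → ℂ)) (R : ℝ) : Prop :=
  IsGreatest {R : ℝ | 0 ≤ R ∧ R ≤ 1 ∧ ∀ r : ℝ, 0 < r → r ≤ R → ∀ f ∈ F, dilation r f ∈ G} R

/-- The Koebe function `z / (1 - z)²`. -/
noncomputable def koebe (z : ℂ) : ℂ := z / (1 - z) ^ 2

/-- The number `2(1-α) / (5 + √(25 + 4α(α-1)))`. -/
noncomputable def convexRadius (α : ℝ) : ℝ :=
  2 * (1 - α) / (5 + Real.sqrt (25 + 4 * α * (α - 1)))

/-- The number `5 - 2√6`. -/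
noncomputable def ucvRadius : ℝ := 5 - 2 * Real.sqrt 6

end UnivalentRadius

namespace UnivalentRadius

open Metric Set Complex MeasureTheory Filter Topology
open scoped ComplexConjugate Real

/-! Everything rests on one disk. For `f ∈ classF6` with companion `g`, put `ω = f'/g' - 1`, a
self-map of the disk fixing 0. Then `f''/f' = g''/g' + ω'/(1+ω)`. Bieberbach's bound `|g''(0)| ≤ 4`,
transported by disk automorphisms, places `g''/g'` in a disk of radius `4/(1-|z|²)` about `2 conj
z/(1-|z|²)`. Schwarz–Pick and the Schwarz lemma bound the other term by `1/(1-|z|)`. With `x = |z|`,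
`norm_preSchwarz_sub_le` then places `z f''/f'` in the disk with centre `2x²/(1-x²)` and radius
`(5x+x²)/(1-x²)`.

For (a), the leftmost point of this disk gives `Re (1 + z f''/f') ≥ (1-5x)/(1-x²)`, which equals `α`
exactly at `x = convexRadius α`. Univalence of the dilations comes from Noshiro–Warschawski on `|z|
< 1/5`, which contains all these radii.

For (b), the condition `|z f''/f'| ≤ Re (1 + z f''/f')` suffices for uniform convexity, and it
describes a parabola with vertex `-1/2`. While the centre is at most `1/2`, the disk lies inside the
parabola as soon as its leftmost point is at least `-1/2`. This is the condition for order `1/2`, so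
the two radii coincide.

Sharpness comes from the Koebe function with `ω(z) = z`, which attains the lower bound for the real
part on the negative axis.

Bieberbach's theorem is derived from an area argument. The image of an annulus `s < |z| < ρ` under
`z⁻¹ + bz + O(z²)` lies in an ellipse; a real linear map turns the ellipse into a disk, so only
areas of disks are needed, and then `s → 0`, `ρ → 1`. -/

/-! ### Image of a disk under a univalent map -/

/-- A connected set through `G 0` that avoids the image of the circle of radius `s` under a univalent
function `G` lies in the image of the disk of radius `s`. -/
theorem subset_image_ball_of_disjoint_image_sphere {G : ℂ → ℂ} {s : ℝ} {U : Set ℂ} (hs : 0 < s)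
    (hs1 : s < 1) (hG : DifferentiableOn ℂ G (ball 0 1)) (hinj : InjOn G (ball 0 1))
    (hU : IsPreconnected U) (h0 : G 0 ∈ U) (hdisj : ∀ z ∈ sphere (0 : ℂ) s, G z ∉ U) :
    U ⊆ G '' ball 0 s := by
  have hopen : IsOpen (G '' ball 0 s) := by
    rcases (hG.analyticOnNhd isOpen_ball).is_constant_or_isOpen
      (convex_ball (0 : ℂ) 1).isPreconnected with ⟨w, hw⟩ | h
    · exfalso
      have h1 : ((s : ℂ)) ∈ ball (0 : ℂ) 1 := by simp [abs_of_pos hs, hs1]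
      have h2 : (0 : ℂ) ∈ ball (0 : ℂ) 1 := by simp
      have := hinj h1 h2 ((hw _ h1).trans (hw _ h2).symm)
      exact hs.ne' (by exact_mod_cast this)
    · exact h _ (ball_subset_ball hs1.le) isOpen_ball
  have hclosed : IsClosed (G '' closedBall 0 s) :=
    ((isCompact_closedBall (0 : ℂ) s).image_of_continuousOn
      (hG.continuousOn.mono (closedBall_subset_ball hs1))).isClosed
  -- The open image of the disk and the complement of the compact image of the closed disk are
  -- disjoint; they cover `U` because `U` misses the image of the circle.
  refine IsPreconnected.subset_left_of_subset_union hopen hclosed.isOpen_compl ?_ ?_ ?_ hU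
  · exact disjoint_compl_right_iff_subset.2 (image_mono ball_subset_closedBall)
  · intro u hu
    by_cases h : u ∈ G '' closedBall 0 s
    · obtain ⟨z, hz, rfl⟩ := h
      rcases (mem_closedBall.1 hz).lt_or_eq with h | h
      · exact Or.inl ⟨z, h, rfl⟩
      · exact absurd hu (hdisj z h)
    · exact Or.inr h
  · exact ⟨G 0, h0, 0, by simpa using hs, rfl⟩

/-! ### The real linear map `w ↦ w - c conj w` -/

/-- The real linear map `w ↦ w - c conj w`. -/
noncomputable def skew (c : ℂ) : ℂ →ₗ[ℝ] ℂ where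
  toFun w := w - c * conj w
  map_add' x y := by simp only [map_add]; ring
  map_smul' r x := by simp [real_smul]; ring

theorem skew_apply (c w : ℂ) : skew c w = w - c * conj w := rfl

/-- This is the area factor by which the ellipse estimate becomes a comparison with a round disk. -/
theorem det_skew (c : ℂ) : LinearMap.det (skew c) = 1 - ‖c‖ ^ 2 := by
  rw [← LinearMap.det_toMatrix basisOneI, Matrix.det_fin_two]
  simp [LinearMap.toMatrix_apply, skew_apply, Complex.sq_norm, normSq_apply]
  ring

theorem norm_skew_le (c w : ℂ) : ‖skew c w‖ ≤ (1 + ‖c‖) * ‖w‖ := by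
  rw [skew_apply]
  calc ‖w - c * conj w‖ ≤ ‖w‖ + ‖c * conj w‖ := norm_sub_le _ _
    _ = _ := by simp; ring

/-- Scaling by `t ≤ 1` multiplies the left side by `t²` and the right side only by `t`. In the
coordinate `u = 1/F` this set is the exterior `‖skew c F‖ ≥ R` of an ellipse together with the point
at infinity; star-shapedness supplies its connectedness. -/
theorem starConvex_skew (c : ℂ) (R : ℝ) :
    StarConvex ℝ 0 {u : ℂ | R * ‖u‖ ^ 2 ≤ ‖skew c (conj u)‖} := by
  rw [starConvex_zero_iff]
  intro u hu t ht0 ht1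
  simp only [mem_ofPred_eq] at hu ⊢
  have h1 : skew c (conj (t • u)) = t • skew c (conj u) := by
    rw [← map_smul]; simp
  rw [h1, norm_smul, norm_smul, Real.norm_of_nonneg ht0]
  have h2 : 0 ≤ ‖skew c (conj u)‖ := norm_nonneg _
  calc R * (t * ‖u‖) ^ 2 = t ^ 2 * (R * ‖u‖ ^ 2) := by ring
    _ ≤ t ^ 2 * ‖skew c (conj u)‖ := by gcongr
    _ ≤ t * ‖skew c (conj u)‖ := by
      gcongr
      nlinarith

theorem norm_skew_inv {c F : ℂ} (hF : F ≠ 0) :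
    ‖skew c (conj F⁻¹)‖ = ‖F⁻¹‖ ^ 2 * ‖skew c F‖ := by
  have h : skew c (conj F⁻¹) = (‖F⁻¹‖ ^ 2) • skew c F := by
    rw [← map_smul]
    congr 1
    rw [real_smul]
    have h2 : conj F * F = (‖F‖ ^ 2 : ℝ) := by
      rw [mul_comm, mul_conj, Complex.sq_norm]
    have h3 : conj F ≠ 0 := by simpa using hF
    have h4 : ((‖F‖ ^ 2 : ℝ) : ℂ) ≠ 0 := by rw [← h2]; exact mul_ne_zero h3 hF
    have : ((‖F⁻¹‖ ^ 2 : ℝ) : ℂ) = ((‖F‖ ^ 2 : ℝ) : ℂ)⁻¹ := by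
      rw [norm_inv]; push_cast; rw [inv_pow]
    rw [this, ← h2, map_inv₀]
    field_simp
  rw [h, norm_smul]; simp

/-! ### Circle averages and areas in polar coordinates -/

/-- Mean value property. It removes the cross terms in the integral of `|F'|²` over a circle. -/
theorem setIntegral_circleMap_eq_zero {Q : ℂ → ℂ} (hQ : DifferentiableOn ℂ Q (ball 0 1))
    (h0 : Q 0 = 0) {t : ℝ} (ht : 0 < t) (ht1 : t < 1) :
    ∫ θ in (-π)..π, (Q (circleMap 0 t θ)).re = 0 := by
  have hsub : closedBall (0 : ℂ) t ⊆ ball 0 1 := closedBall_subset_ball ht1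
  have h1 : Real.circleAverage Q 0 t = 0 := by
    rw [DiffContOnCl.circleAverage, h0]
    rw [abs_of_pos ht]
    exact (hQ.mono (hsub)).diffContOnCl_ball subset_rfl
  have hcont : Continuous fun θ : ℝ => Q (circleMap 0 t θ) := by
    refine hQ.continuousOn.comp_continuous (continuous_circleMap 0 t) fun θ => hsub ?_
    exact circleMap_mem_closedBall 0 ht.le θ
  have h2 : ∫ θ in (0 : ℝ)..2 * π, Q (circleMap 0 t θ) = 0 := by
    rw [Real.circleAverage_def] at h1
    have : (2 * π)⁻¹ ≠ 0 := by positivity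
    exact (smul_eq_zero.1 h1).resolve_left this
  have h3 : ∫ θ in (-π)..π, Q (circleMap 0 t θ) = 0 := by
    have hp : (fun θ => Q (circleMap 0 t θ)).Periodic (2 * π) := fun x => by
      simp [periodic_circleMap 0 t x]
    have := hp.intervalIntegral_add_eq (-π) 0
    rwa [zero_add, h2, show -π + 2 * π = π by ring] at this
  have h4 : ∫ θ in (-π)..π, (Q (circleMap 0 t θ)).re
      = (∫ θ in (-π)..π, Q (circleMap 0 t θ)).re := by
    exact reCLM.intervalIntegral_comp_comm (hcont.intervalIntegrable _ _)
  rw [h4, h3]; simp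

/-- If the integrals of `h` over the circles `|z| = t` are at least `A t`, then the integral of `h`
over the annulus `s < |z| < ρ` is at least the integral of `t A(t)`. -/
theorem le_lintegral_annulus {h : ℂ → ℝ} {A : ℝ → ℝ} {s ρ : ℝ} (hs : 0 < s) (hsρ : s ≤ ρ)
    (hc : ContinuousOn h (ball 0 ρ \ closedBall 0 s)) (h0 : ∀ z, 0 ≤ h z)
    (hAc : ContinuousOn A (Icc s ρ))
    (hA0 : ∀ t ∈ Ioo s ρ, 0 ≤ A t)
    (hA : ∀ t ∈ Ioo s ρ, A t ≤ ∫ θ in (-π)..π, h (circleMap 0 t θ)) :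
    ENNReal.ofReal (∫ t in s..ρ, t * A t) ≤
      ∫⁻ z in ball (0 : ℂ) ρ \ closedBall 0 s, ENNReal.ofReal (h z) := by
  set D : Set ℂ := ball (0 : ℂ) ρ \ closedBall 0 s with hD
  have hDm : MeasurableSet D := measurableSet_ball.diff measurableSet_closedBall
  have hpm : ∀ t ∈ Ioo s ρ, ∀ θ : ℝ, circleMap 0 t θ ∈ D := by
    intro t ht θ
    have : ‖circleMap 0 t θ‖ = t := by
      simp [abs_of_pos (hs.trans ht.1)]
    rw [hD, Set.mem_sdiff, mem_ball_zero_iff, mem_closedBall_zero_iff, this]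
    exact ⟨ht.2, not_le.2 ht.1⟩
  have hpol : ∀ p : ℝ × ℝ, Complex.polarCoord.symm p = circleMap 0 p.1 p.2 := by
    intro p; rw [Complex.polarCoord_symm_apply, circleMap_zero, exp_mul_I]; push_cast; rfl
  rw [← lintegral_indicator hDm, ← Complex.lintegral_comp_polarCoord_symm]
  have hrect : Ioo s ρ ×ˢ Ioo (-π) π ⊆ polarCoord.target := by
    rw [polarCoord_target]
    exact prod_mono (fun t ht => hs.trans ht.1) subset_rfl
  have hmR : MeasurableSet (Ioo s ρ ×ˢ Ioo (-π) π) := measurableSet_Ioo.prod measurableSet_Ioo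
  refine le_trans ?_ (lintegral_mono_set hrect)
  have hcm : Continuous fun p : ℝ × ℝ => circleMap 0 p.1 p.2 := by
    unfold circleMap; fun_prop
  have hcont : ContinuousOn (fun p : ℝ × ℝ => p.1 * h (circleMap 0 p.1 p.2))
      (Ioo s ρ ×ˢ Ioo (-π) π) := by
    refine continuousOn_fst.mul (hc.comp hcm.continuousOn fun p hp => hpm _ hp.1 _)
  have e1 : ∫⁻ p in Ioo s ρ ×ˢ Ioo (-π) π, ENNReal.ofReal p.1 •
      D.indicator (fun z => ENNReal.ofReal (h z)) (Complex.polarCoord.symm p)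
      = ∫⁻ p in Ioo s ρ ×ˢ Ioo (-π) π, ENNReal.ofReal (p.1 * h (circleMap 0 p.1 p.2)) := by
    refine setLIntegral_congr_fun hmR fun p hp => ?_
    rw [hpol, indicator_of_mem (hpm _ hp.1 _), smul_eq_mul,
      ENNReal.ofReal_mul (hs.trans hp.1.1).le]
  rw [e1, Measure.volume_eq_prod, ← Measure.prod_restrict, lintegral_prod]
  · have hint : IntervalIntegrable (fun t => t * A t) volume s ρ := by
      apply ContinuousOn.intervalIntegrable
      rw [uIcc_of_le hsρ]
      exact continuousOn_id.mul hAc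
    rw [intervalIntegral.integral_of_le hsρ, integral_Ioc_eq_integral_Ioo,
      ofReal_integral_eq_lintegral_ofReal]
    · refine setLIntegral_mono' measurableSet_Ioo fun t ht => ?_
      have htp : 0 < t := hs.trans ht.1
      have hct : Continuous fun θ : ℝ => t * h (circleMap 0 t θ) :=
        continuous_const.mul (hc.comp_continuous (continuous_circleMap 0 t) fun θ => hpm t ht θ)
      have hI : IntegrableOn (fun θ : ℝ => t * h (circleMap 0 t θ)) (Ioo (-π) π) :=
        (hct.integrableOn_Icc).mono_set Ioo_subset_Icc_self
      simp only
      rw [← ofReal_integral_eq_lintegral_ofReal hI (Eventually.of_forall fun θ =>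
        mul_nonneg htp.le (h0 _))]
      refine ENNReal.ofReal_le_ofReal ?_
      rw [integral_const_mul, ← integral_Ioc_eq_integral_Ioo,
        ← intervalIntegral.integral_of_le (by linarith [Real.pi_pos])]
      exact mul_le_mul_of_nonneg_left (hA t ht) htp.le
    · exact (intervalIntegrable_iff_integrableOn_Ioo_of_le hsρ).1 hint
    · refine (ae_restrict_iff' measurableSet_Ioo).2 (Eventually.of_forall fun t ht => ?_)
      exact mul_nonneg (hs.trans ht.1).le (hA0 t ht)
  · rw [Measure.prod_restrict, ← Measure.volume_eq_prod]
    exact (hcont.aemeasurable hmR).ennreal_ofReal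

/-! ### The area theorem -/

/-- Change of variables: the real Jacobian of a holomorphic map is `|F'|²`. -/
theorem volume_image_eq_lintegral {F F' : ℂ → ℂ} {A : Set ℂ} (hA : MeasurableSet A)
    (hF : ∀ z ∈ A, HasDerivAt F (F' z) z) (hinj : InjOn F A) :
    volume (F '' A) = ∫⁻ z in A, ENNReal.ofReal (‖F' z‖ ^ 2) := by
  rw [← lintegral_abs_det_fderiv_eq_addHaar_image volume hA
    (fun z hz => ((hF z hz).hasFDerivAt.restrictScalars ℝ).hasFDerivWithinAt) hinj]
  refine setLIntegral_congr_fun hA fun z hz => ?_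
  have : ((ContinuousLinearMap.toSpanSingleton ℂ (F' z)).restrictScalars ℝ).det
      = ‖F' z‖ ^ 2 := by
    simp [ContinuousLinearMap.det, LinearMap.det_restrictScalars, Complex.sq_norm,
      Algebra.norm_complex_apply]
  rw [this, abs_of_nonneg (by positivity)]

/-- The exterior of the circle of radius `s` is mapped by `z⁻¹ + b z + z² k(z)` into an ellipse. -/
theorem norm_skew_lt {b : ℂ} {k F : ℂ → ℂ} (hk : DifferentiableOn ℂ k (ball 0 1))
    (hF : ∀ z, F z = z⁻¹ + b * z + z ^ 2 * k z)
    (hne : ∀ z ∈ ball (0 : ℂ) 1, z ≠ 0 → F z ≠ 0) (hinj : InjOn F (ball 0 1 \ {0}))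
    {s M R : ℝ} (hs : 0 < s) (hs1 : s < 1) (hM : ∀ z ∈ sphere (0 : ℂ) s, ‖k z‖ ≤ M)
    (hb : ‖b‖ * s ^ 2 ≤ 1) (hR : 1 / s + 2 * M * s ^ 2 < R) {z : ℂ} (hsz : s < ‖z‖) (hz : ‖z‖ < 1) :
    ‖skew (b * s ^ 2) (F z)‖ < R := by
  -- On `|z| = s` one has `z = s² conj z⁻¹`, so `z⁻¹ + bz = z⁻¹ + c conj z⁻¹` runs over an ellipse,
  -- which `skew c` maps to the circle of radius `(1-‖c‖²)/s`. The remainder `z² k` adds at most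
  -- `2Ms²`.
  set c : ℂ := b * s ^ 2 with hc
  have hcn : ‖c‖ ≤ 1 := by rw [hc]; simpa using hb
  have hsph : ∀ z ∈ sphere (0 : ℂ) s, ‖skew c (F z)‖ < R := by
    intro z hz
    have hzn : ‖z‖ = s := by simpa using hz
    have hz0 : z ≠ 0 := by rw [← norm_pos_iff, hzn]; exact hs
    have h1 : conj z⁻¹ * s ^ 2 = z := by
      rw [map_inv₀, ← hzn, ← ofReal_pow, Complex.sq_norm, ← mul_conj]
      have : conj z ≠ 0 := by simpa using hz0
      field_simp
    have h2 : F z = (z⁻¹ + c * conj z⁻¹) + z ^ 2 * k z := by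
      rw [hF, hc]; linear_combination (-b) * h1
    have h3 : skew c (z⁻¹ + c * conj z⁻¹) = (1 - ‖c‖ ^ 2 : ℝ) * z⁻¹ := by
      have : c * conj c = (‖c‖ ^ 2 : ℝ) := by rw [mul_conj, Complex.sq_norm]
      rw [skew_apply]; push_cast at this ⊢; rw [← this]
      simp only [map_add, map_mul, conj_conj]; ring
    rw [h2, map_add, h3]
    refine lt_of_le_of_lt (norm_add_le _ _) (lt_of_le_of_lt (add_le_add ?_ ?_) hR)
    · rw [norm_mul, norm_inv, hzn, norm_real, Real.norm_of_nonneg (by nlinarith [norm_nonneg c]),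
        one_div]
      exact mul_le_of_le_one_left (by positivity) (by nlinarith [norm_nonneg c])
    · refine (norm_skew_le _ _).trans ?_
      rw [norm_mul (z ^ 2), norm_pow z, hzn]
      have := hM z hz
      calc (1 + ‖c‖) * (s ^ 2 * ‖k z‖) ≤ (1 + 1) * (s ^ 2 * M) := by gcongr
        _ = _ := by ring
  -- `G = 1/F`, written so that it extends holomorphically and injectively over 0.
  set G : ℂ → ℂ := fun z => z / (1 + b * z ^ 2 + z ^ 3 * k z) with hG
  have hden : ∀ z, z ≠ 0 → 1 + b * z ^ 2 + z ^ 3 * k z = z * F z := by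
    intro z hz; rw [hF]; field_simp
  have hden0 : ∀ z ∈ ball (0 : ℂ) 1, 1 + b * z ^ 2 + z ^ 3 * k z ≠ 0 := by
    intro z hz
    by_cases h : z = 0
    · simp [h]
    · rw [hden z h]; exact mul_ne_zero h (hne z hz h)
  have hGF : ∀ z, z ≠ 0 → G z = (F z)⁻¹ := by
    intro z hz
    simp only [hG]
    rw [hden z hz]; field_simp
  have hG0 : G 0 = 0 := by simp [hG]
  have hGd : DifferentiableOn ℂ G (ball 0 1) := by
    refine DifferentiableOn.div differentiableOn_id ?_ hden0
    fun_prop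
  have hGinj : InjOn G (ball 0 1) := by
    intro x hx y hy hxy
    by_cases h1 : x = 0 <;> by_cases h2 : y = 0
    · rw [h1, h2]
    · rw [h1, hG0, hGF y h2] at hxy
      exact absurd (inv_eq_zero.1 hxy.symm) (hne y hy h2)
    · rw [h2, hG0, hGF x h1] at hxy
      exact absurd (inv_eq_zero.1 hxy) (hne x hx h1)
    · rw [hGF x h1, hGF y h2] at hxy
      exact hinj ⟨hx, h1⟩ ⟨hy, h2⟩ (inv_injective hxy)
  by_contra hcon
  rw [not_lt] at hcon
  have hz0 : z ≠ 0 := by rw [← norm_pos_iff]; exact hs.trans hsz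
  have hzb : z ∈ ball (0 : ℂ) 1 := by simpa using hz
  -- The star-shaped set misses the image of `|w| = s`, hence lies in the image of `|w| < s`. If `G
  -- z` were in it, injectivity would force `|z| < s`.
  have hU := subset_image_ball_of_disjoint_image_sphere
    (U := {u : ℂ | R * ‖u‖ ^ 2 ≤ ‖skew c (conj u)‖}) hs hs1 hGd hGinj
    ((starConvex_skew c R).isPathConnected (by simp)).isConnected.isPreconnected
    (by simp [hG0]) (by
      intro w hw
      have hwn : ‖w‖ = s := by simpa using hw
      have hw0 : w ≠ 0 := by rw [← norm_pos_iff, hwn]; exact hs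
      have hwb : w ∈ ball (0 : ℂ) 1 := by simpa [hwn] using hs1
      have hFw := hne w hwb hw0
      rw [mem_ofPred_eq, hGF w hw0, norm_skew_inv hFw, not_le, mul_comm]
      have : 0 < ‖(F w)⁻¹‖ := by simpa using hFw
      exact mul_lt_mul_of_pos_right (hsph w hw) (by positivity) |>.trans_eq' (by ring))
  obtain ⟨w, hw, hwz⟩ := hU (show G z ∈ _ by
    have hFz := hne z hzb hz0
    rw [mem_ofPred_eq, hGF z hz0, norm_skew_inv hFz, mul_comm]
    gcongr)
  have := hGinj (ball_subset_ball hs1.le hw) hzb hwz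
  rw [this] at hw
  exact absurd (mem_ball_zero_iff.1 hw) (not_lt.2 hsz.le)

/-- On `|z| = t` one has `conj (z⁻²) = z²/t⁴`, so in the expansion of the square all cross terms
form the real part of a holomorphic `Q` with `Q 0 = 0` and integrate to zero. The term `‖e‖²` is
dropped. -/
theorem le_integral_norm_sq_circleMap {b : ℂ} {e : ℂ → ℂ} (he : DifferentiableOn ℂ e (ball 0 1))
    (he0 : e 0 = 0) {t : ℝ} (ht : 0 < t) (ht1 : t < 1) :
    2 * π * ((t ^ 4)⁻¹ + ‖b‖ ^ 2) ≤
      ∫ θ in (-π)..π, ‖-(circleMap 0 t θ ^ 2)⁻¹ + b + e (circleMap 0 t θ)‖ ^ 2 := by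
  set Q : ℂ → ℂ := fun z =>
    -2 * (b * z ^ 2) / t ^ 4 - 2 * (z ^ 2 * e z) / t ^ 4 + 2 * (conj b * e z) with hQ
  have hQd : DifferentiableOn ℂ Q (ball 0 1) := by
    simp only [hQ]; fun_prop
  have hQ0 : Q 0 = 0 := by simp [hQ, he0]
  have hpt : ∀ z : ℂ, ‖z‖ = t →
      (t ^ 4)⁻¹ + ‖b‖ ^ 2 + (Q z).re ≤ ‖-(z ^ 2)⁻¹ + b + e z‖ ^ 2 := by
    intro z hz
    have hz0 : z ≠ 0 := by rw [← norm_pos_iff, hz]; exact ht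
    have ht4 : (t ^ 4 : ℂ) = z ^ 2 * conj z ^ 2 := by
      rw [← mul_pow, mul_conj, normSq_eq_norm_sq, hz]; push_cast; ring
    have hcz : conj z ≠ 0 := by simpa using hz0
    have e1 : ((z ^ 2)⁻¹ : ℂ) = conj z ^ 2 / t ^ 4 := by
      rw [ht4]; field_simp
    have e2 : (‖-(z ^ 2)⁻¹ + b + e z‖ ^ 2 : ℝ)
        = (t ^ 4)⁻¹ + ‖b‖ ^ 2 + (Q z).re + ‖e z‖ ^ 2 := by
      have key : ∀ x y w : ℂ, ‖-x + y + w‖ ^ 2 = ‖x‖ ^ 2 + ‖y‖ ^ 2 + ‖w‖ ^ 2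
          + (-2 * (y * conj x) - 2 * (conj x * w) + 2 * (conj y * w)).re := by
        intro x y w
        simp only [Complex.sq_norm, normSq_apply]
        simp
        ring
      rw [key]
      have e3 : conj ((z ^ 2)⁻¹) = z ^ 2 / t ^ 4 := by rw [e1]; simp
      have e4 : ‖(z ^ 2)⁻¹‖ ^ 2 = (t ^ 4)⁻¹ := by
        rw [norm_inv, norm_pow, hz]; ring
      rw [e3, e4]
      have e5 : (-2 * (b * (z ^ 2 / t ^ 4)) - 2 * (z ^ 2 / t ^ 4 * e z) + 2 * (conj b * e z))
          = Q z := by simp only [hQ]; ring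
      rw [e5]; ring
    rw [e2]
    nlinarith [sq_nonneg ‖e z‖]
  have hn : ∀ θ, ‖circleMap 0 t θ‖ = t := fun θ => by simp [abs_of_pos ht]
  have hmem : ∀ θ, circleMap 0 t θ ∈ ball (0 : ℂ) 1 := fun θ => by
    rw [mem_ball_zero_iff, hn]; exact ht1
  have hcQ : Continuous fun θ : ℝ => (Q (circleMap 0 t θ)).re :=
    continuous_re.comp (hQd.continuousOn.comp_continuous (continuous_circleMap 0 t) hmem)
  have hce : Continuous fun θ : ℝ => ‖-(circleMap 0 t θ ^ 2)⁻¹ + b + e (circleMap 0 t θ)‖ ^ 2 := by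
    have h1 := he.continuousOn.comp_continuous (continuous_circleMap 0 t) hmem
    have h2 : ∀ θ, circleMap 0 t θ ^ 2 ≠ 0 := fun θ => by
      apply pow_ne_zero; rw [← norm_pos_iff, hn]; exact ht
    have h3 := ((continuous_circleMap 0 t).pow 2).inv₀ h2
    exact (((h3.neg.add continuous_const).add h1).norm).pow 2
  have hmono := intervalIntegral.integral_mono_on (μ := volume) (a := -π) (b := π)
    (by linarith [Real.pi_pos])
    ((continuous_const.add hcQ).intervalIntegrable (-π) π) (hce.intervalIntegrable (-π) π)
    (fun θ _ => hpt _ (hn θ))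
  refine le_trans (le_of_eq ?_) hmono
  simp only [Pi.add_apply]
  rw [intervalIntegral.integral_add intervalIntegrable_const (hcQ.intervalIntegrable _ _),
    setIntegral_circleMap_eq_zero hQd hQ0 ht ht1, intervalIntegral.integral_const, smul_eq_mul]
  ring

theorem integral_mul_inv_pow_four_add {B s ρ : ℝ} (hs : 0 < s) (hsρ : s ≤ ρ) :
    ∫ t in s..ρ, t * (2 * π * ((t ^ 4)⁻¹ + B)) =
      π * ((s ^ 2)⁻¹ - (ρ ^ 2)⁻¹ + B * (ρ ^ 2 - s ^ 2)) := by
  have hpos : ∀ t ∈ uIcc s ρ, 0 < t := fun t ht => by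
    rw [uIcc_of_le hsρ] at ht; exact hs.trans_le ht.1
  rw [intervalIntegral.integral_eq_sub_of_hasDerivAt
    (f := fun t => π * (-(t ^ 2)⁻¹ + B * t ^ 2))]
  · ring
  · intro t ht
    have h0 := (hpos t ht).ne'
    have h1 := (((hasDerivAt_pow 2 t).inv (pow_ne_zero 2 h0)).neg.add
      ((hasDerivAt_pow 2 t).const_mul B)).const_mul π
    refine h1.congr_deriv ?_
    simp only [Nat.cast_ofNat]
    field_simp
    ring
  · refine ContinuousOn.intervalIntegrable ?_
    refine continuousOn_id.mul (continuousOn_const.mul (ContinuousOn.add ?_ continuousOn_const))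
    exact ContinuousOn.inv₀ (by fun_prop) fun t ht => pow_ne_zero 4 (hpos t ht).ne'

/-- The image of the annulus `s < |z| < ρ` is sent by `skew (b s²)` into the disk of radius `R`. Its
area, bounded below by integrating the circle estimates, times the determinant is at most `πR²`. -/
theorem area_inequality {b : ℂ} {k F : ℂ → ℂ} (hk : DifferentiableOn ℂ k (ball 0 1))
    (hF : ∀ z, F z = z⁻¹ + b * z + z ^ 2 * k z)
    (hne : ∀ z ∈ ball (0 : ℂ) 1, z ≠ 0 → F z ≠ 0) (hinj : InjOn F (ball 0 1 \ {0}))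
    {s M R ρ : ℝ} (hs : 0 < s) (hsρ : s ≤ ρ) (hρ : ρ < 1) (hM : ∀ z ∈ sphere (0 : ℂ) s, ‖k z‖ ≤ M)
    (hb : ‖b‖ * s ^ 2 ≤ 1) (hR : 1 / s + 2 * M * s ^ 2 < R) (hR0 : 0 ≤ R) :
    (1 - ‖b‖ ^ 2 * s ^ 4) * ((s ^ 2)⁻¹ - (ρ ^ 2)⁻¹ + ‖b‖ ^ 2 * (ρ ^ 2 - s ^ 2)) ≤ R ^ 2 := by
  set A : Set ℂ := ball (0 : ℂ) ρ \ closedBall 0 s with hA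
  have hAm : MeasurableSet A := measurableSet_ball.diff measurableSet_closedBall
  have hAn : ∀ z ∈ A, s < ‖z‖ ∧ ‖z‖ < ρ := fun z hz => by
    rw [hA, Set.mem_sdiff, mem_ball_zero_iff, mem_closedBall_zero_iff, not_le] at hz
    exact ⟨hz.2, hz.1⟩
  have hA0 : ∀ z ∈ A, z ≠ 0 := fun z hz => by
    rw [← norm_pos_iff]; exact hs.trans (hAn z hz).1
  have hA1 : A ⊆ ball 0 1 := fun z hz => by
    rw [mem_ball_zero_iff]; exact (hAn z hz).2.trans hρ
  have hAs : A ⊆ ball 0 1 \ {0} := fun z hz => ⟨hA1 hz, hA0 z hz⟩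
  set e : ℂ → ℂ := fun z => 2 * z * k z + z ^ 2 * deriv k z with he
  have hkd : DifferentiableOn ℂ (deriv k) (ball 0 1) := hk.deriv isOpen_ball
  have hed : DifferentiableOn ℂ e (ball 0 1) := by simp only [he]; fun_prop
  have he0 : e 0 = 0 := by simp [he]
  have hder : ∀ z ∈ A, HasDerivAt F (-(z ^ 2)⁻¹ + b + e z) z := by
    intro z hz
    have h1 := (hk.differentiableAt (isOpen_ball.mem_nhds (hA1 hz))).hasDerivAt
    have h2 := ((hasDerivAt_inv (hA0 z hz)).add ((hasDerivAt_id z).const_mul b)).add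
      ((hasDerivAt_pow 2 z).mul h1)
    have h3 : F = fun z => z⁻¹ + b * z + z ^ 2 * k z := funext hF
    rw [h3]
    refine h2.congr_deriv ?_
    simp [he]
  have hvol := volume_image_eq_lintegral hAm hder (hinj.mono hAs)
  have hcont : ContinuousOn (fun z => ‖-(z ^ 2)⁻¹ + b + e z‖ ^ 2) A := by
    refine ((((ContinuousOn.inv₀ (by fun_prop) fun z hz => pow_ne_zero 2 (hA0 z hz)).neg.add
      continuousOn_const).add (hed.continuousOn.mono hA1)).norm).pow 2
  have hlow := le_lintegral_annulus (A := fun t => 2 * π * ((t ^ 4)⁻¹ + ‖b‖ ^ 2)) hs hsρ hcont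
    (fun z => by positivity)
    (by
      refine continuousOn_const.mul (ContinuousOn.add ?_ continuousOn_const)
      exact ContinuousOn.inv₀ (by fun_prop) fun t ht => pow_ne_zero 4 (hs.trans_le ht.1).ne')
    (fun t ht => by positivity)
    (fun t ht => le_integral_norm_sq_circleMap hed he0 (hs.trans ht.1) (ht.2.trans hρ))
  rw [integral_mul_inv_pow_four_add hs hsρ, ← hvol] at hlow
  set c : ℂ := b * s ^ 2 with hc
  have hcn : ‖c‖ ^ 2 = ‖b‖ ^ 2 * s ^ 4 := by
    rw [hc]; simp; ring
  have hc1 : 0 ≤ 1 - ‖c‖ ^ 2 := by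
    have : ‖c‖ ≤ 1 := by rw [hc]; simpa using hb
    nlinarith [norm_nonneg c]
  have hsub : skew c '' (F '' A) ⊆ ball 0 R := by
    rintro _ ⟨_, ⟨z, hz, rfl⟩, rfl⟩
    rw [mem_ball_zero_iff]
    exact norm_skew_lt hk hF hne hinj hs (hsρ.trans_lt hρ) hM hb hR (hAn z hz).1
      ((hAn z hz).2.trans hρ)
  have hup := measure_mono (μ := volume) hsub
  rw [Measure.addHaar_image_linearMap, det_skew, abs_of_nonneg hc1, Complex.volume_ball] at hup
  have h5 : ENNReal.ofReal ((1 - ‖c‖ ^ 2) * (π * ((s ^ 2)⁻¹ - (ρ ^ 2)⁻¹ + ‖b‖ ^ 2 * (ρ ^ 2 - s ^ 2))))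
      ≤ ENNReal.ofReal (R ^ 2 * π) := by
    rw [ENNReal.ofReal_mul hc1]
    refine (mul_le_mul_right hlow _).trans (hup.trans (le_of_eq ?_))
    rw [ENNReal.ofReal_mul (by positivity), ENNReal.ofReal_pow hR0]
    congr 1
    rw [← NNReal.coe_real_pi, ENNReal.ofReal_coe_nnreal]
  rw [ENNReal.ofReal_le_ofReal_iff (by positivity)] at h5
  rw [hcn] at h5
  refine le_of_mul_le_mul_right ?_ Real.pi_pos
  linarith

/-- Grönwall's area theorem, first coefficient: if `z⁻¹ + b z + O(z²)` is univalent and nonvanishing in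
the punctured unit disk, then `‖b‖ ≤ 1`. -/
theorem norm_le_one_of_injOn_inv_add {b : ℂ} {k F : ℂ → ℂ} (hk : DifferentiableOn ℂ k (ball 0 1))
    (hF : ∀ z, F z = z⁻¹ + b * z + z ^ 2 * k z)
    (hne : ∀ z ∈ ball (0 : ℂ) 1, z ≠ 0 → F z ≠ 0) (hinj : InjOn F (ball 0 1 \ {0})) :
    ‖b‖ ≤ 1 := by
  obtain ⟨M, hM⟩ := (isCompact_closedBall (0 : ℂ) (1 / 2)).exists_bound_of_continuousOn
    (hk.continuousOn.mono (closedBall_subset_ball (by norm_num)))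
  have hM0 : 0 ≤ M := (norm_nonneg _).trans (hM 0 (by simp))
  set C : ℝ := 2 * M + 1 with hC
  set β : ℝ := ‖b‖ ^ 2 with hβ
  have hβ0 : 0 ≤ β := by positivity
  have hstep : ∀ ρ : ℝ, 0 < ρ → ρ < 1 → -(ρ ^ 2)⁻¹ + β * ρ ^ 2 ≤ 0 := by
    intro ρ hρ hρ1
    -- This expression is what remains on the right when `area_inequality` is applied with `R = 1/s
    -- + C s²`, the two `s⁻²` terms cancel, and `-ρ⁻² + βρ²` stays on the left. The extra 1 in `C =
    -- 2M + 1` makes the hypothesis on `R` strict.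
    have hlim : Tendsto (fun s : ℝ => 2 * C * s + C ^ 2 * s ^ 4 + 2 * β * s ^ 2
        - β * s ^ 4 * (ρ ^ 2)⁻¹ + β ^ 2 * s ^ 4 * ρ ^ 2 - β ^ 2 * s ^ 6) (𝓝[>] 0) (𝓝 0) := by
      have : Continuous (fun s : ℝ => 2 * C * s + C ^ 2 * s ^ 4 + 2 * β * s ^ 2
        - β * s ^ 4 * (ρ ^ 2)⁻¹ + β ^ 2 * s ^ 4 * ρ ^ 2 - β ^ 2 * s ^ 6) := by fun_prop
      have := (this.tendsto 0).mono_left (nhdsWithin_le_nhds (s := Ioi 0))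
      simpa using this
    have hbs : ∀ᶠ s : ℝ in 𝓝[>] 0, ‖b‖ * s ^ 2 < 1 := by
      have : Continuous fun s : ℝ => ‖b‖ * s ^ 2 := by fun_prop
      have := (this.tendsto 0).mono_left (nhdsWithin_le_nhds (s := Ioi 0))
      exact this.eventually_lt_const (by simp)
    refine ge_of_tendsto hlim ?_
    filter_upwards [hbs, Ioo_mem_nhdsGT (show (0 : ℝ) < 1 / 2 by norm_num),
      Ioo_mem_nhdsGT hρ] with s hs1 hs2 hs3
    have hs := hs2.1
    have := area_inequality (M := M) (R := 1 / s + C * s ^ 2) hk hF hne hinj hs hs3.2.le hρ1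
      (fun z hz => hM z (sphere_subset_closedBall.trans (closedBall_subset_closedBall hs2.2.le) hz))
      hs1.le (by rw [hC]; nlinarith [sq_pos_of_pos hs]) (by positivity)
    rw [← hβ] at this
    have e1 : (1 / s + C * s ^ 2) ^ 2 = (s ^ 2)⁻¹ + 2 * C * s + C ^ 2 * s ^ 4 := by
      field_simp
      ring
    have e2 : (1 - β * s ^ 4) * ((s ^ 2)⁻¹ - (ρ ^ 2)⁻¹ + β * (ρ ^ 2 - s ^ 2)) =
        (s ^ 2)⁻¹ - (ρ ^ 2)⁻¹ + β * ρ ^ 2 - 2 * β * s ^ 2 + β * s ^ 4 * (ρ ^ 2)⁻¹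
          - β ^ 2 * s ^ 4 * ρ ^ 2 + β ^ 2 * s ^ 6 := by
      field_simp
      ring
    rw [e1, e2] at this
    linarith
  have hlim : Tendsto (fun ρ : ℝ => -(ρ ^ 2)⁻¹ + β * ρ ^ 2) (𝓝[<] 1) (𝓝 (-1 + β)) := by
    have : ContinuousAt (fun ρ : ℝ => -(ρ ^ 2)⁻¹ + β * ρ ^ 2) 1 := by
      refine ContinuousAt.add (ContinuousAt.neg (ContinuousAt.inv₀ (by fun_prop) (by norm_num)))
        (by fun_prop)
    have := this.tendsto.mono_left (nhdsWithin_le_nhds (s := Iio 1))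
    simpa using this
  have hle := le_of_tendsto hlim (by
    filter_upwards [Ioo_mem_nhdsLT (show (0 : ℝ) < 1 by norm_num)] with ρ hρ
    exact hstep ρ hρ.1 hρ.2)
  have : ‖b‖ ^ 2 ≤ 1 := by linarith
  nlinarith [norm_nonneg b]

/-! ### Logarithms of nonvanishing functions on a disk -/

/-- Take a primitive `l` of `φ'/φ`; then `φ exp(-l)` has zero derivative. -/
theorem exists_exp_eq_of_ne_zero {φ : ℂ → ℂ} {r : ℝ} (hr : 0 < r)
    (hφ : DifferentiableOn ℂ φ (ball 0 r)) (h0 : ∀ z ∈ ball (0 : ℂ) r, φ z ≠ 0) (h1 : φ 0 = 1) :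
    ∃ l : ℂ → ℂ, l 0 = 0 ∧ (∀ z ∈ ball (0 : ℂ) r, HasDerivAt l (deriv φ z / φ z) z) ∧
      ∀ z ∈ ball (0 : ℂ) r, φ z = exp (l z) := by
  obtain ⟨l, hl0, hl⟩ := IsExactOn.with_val_at
    (((hφ.deriv isOpen_ball).div hφ h0).isExactOn_ball) 0 0
  refine ⟨l, hl0, hl, fun z hz => ?_⟩
  have hd : ∀ w ∈ ball (0 : ℂ) r, HasDerivAt (fun w => φ w * exp (-l w)) 0 w := by
    intro w hw
    have h2 := (hφ.differentiableAt (isOpen_ball.mem_nhds hw)).hasDerivAt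
    refine (h2.mul (hl w hw).neg.cexp).congr_deriv ?_
    have := h0 w hw
    simp only [Pi.div_apply]
    field_simp
    ring
  have hc : φ z * exp (-l z) = φ 0 * exp (-l 0) := by
    refine isOpen_ball.is_const_of_deriv_eq_zero (convex_ball (0 : ℂ) r).isPreconnected
      (fun w hw => (hd w hw).differentiableAt.differentiableWithinAt)
      (fun w hw => (hd w hw).deriv) hz (mem_ball_self hr)
  rw [h1, hl0, neg_zero, exp_zero, mul_one, exp_neg] at hc
  field_simp at hc
  exact hc

/-! ### Bieberbach's theorem on the second coefficient -/

theorem differentiableOn_dslope_zero {f : ℂ → ℂ} (hf : DifferentiableOn ℂ f (ball 0 1)) :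
    DifferentiableOn ℂ (dslope f 0) (ball 0 1) :=
  (differentiableOn_dslope (ball_mem_nhds 0 one_pos)).2 hf

theorem eq_add_mul_dslope (f : ℂ → ℂ) (z : ℂ) : f z = f 0 + z * dslope f 0 z := by
  have := sub_smul_dslope f 0 z
  rw [sub_zero, smul_eq_mul] at this
  rw [this]; ring

theorem deriv_deriv_eq_two_mul_deriv_dslope {f : ℂ → ℂ} (hf : DifferentiableOn ℂ f (ball 0 1)) :
    deriv (deriv f) 0 = 2 * deriv (dslope f 0) 0 := by
  have hφ := differentiableOn_dslope_zero hf
  have hd : ∀ z ∈ ball (0 : ℂ) 1, deriv f z = dslope f 0 z + z * deriv (dslope f 0) z := by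
    intro z hz
    have h1 := (hφ.differentiableAt (isOpen_ball.mem_nhds hz)).hasDerivAt
    have h2 : f = fun z => f 0 + z * dslope f 0 z := funext (eq_add_mul_dslope f)
    have h3 := ((hasDerivAt_id z).mul h1).const_add (f 0)
    have h4 := (h3.congr_of_eventuallyEq (Eventually.of_forall fun w => by
      simpa using eq_add_mul_dslope f w)).deriv
    rw [h4]; simp
  have hev : deriv f =ᶠ[𝓝 0] fun z => dslope f 0 z + z * deriv (dslope f 0) z := by
    filter_upwards [ball_mem_nhds (0 : ℂ) one_pos] with z hz using hd z hz
  rw [hev.deriv_eq]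
  have m0 : ball (0 : ℂ) 1 ∈ 𝓝 0 := ball_mem_nhds 0 one_pos
  have h1 := (hφ.differentiableAt m0).hasDerivAt
  have h2 := ((hφ.deriv isOpen_ball).differentiableAt m0).hasDerivAt
  have h3 := (h1.add ((hasDerivAt_id (0 : ℂ)).mul h2)).deriv
  refine Eq.trans h3 ?_
  simp; ring

/-- Bieberbach's theorem: `‖f''(0)‖ ≤ 4` for `f` in the class `𝒮`. -/
theorem norm_deriv_deriv_zero_le_four {g : ℂ → ℂ} (hg : g ∈ classS) :
    ‖deriv (deriv g) 0‖ ≤ 4 := by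
  obtain ⟨⟨hd, h0, h1⟩, hinj⟩ := hg
  simp only [unitDisk] at hd hinj
  have hφ := differentiableOn_dslope_zero hd
  set φ := dslope g 0 with hφdef
  have hgφ : ∀ z, g z = z * φ z := fun z => by rw [eq_add_mul_dslope g z, h0, zero_add]
  have hφ0 : φ 0 = 1 := by rw [hφdef, dslope_same, h1]
  have z0 : (0 : ℂ) ∈ ball (0 : ℂ) 1 := mem_ball_self one_pos
  have hφne : ∀ z ∈ ball (0 : ℂ) 1, φ z ≠ 0 := by
    intro z hz h
    by_cases hz0 : z = 0
    · rw [hz0, hφ0] at h; exact one_ne_zero h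
    · exact hz0 (hinj hz z0 (by rw [h0, hgφ z, h, mul_zero]))
  obtain ⟨l, hl0, hld, hlφ⟩ := exists_exp_eq_of_ne_zero one_pos hφ hφne hφ0
  -- `m = φ^(-1/2)`, so `F(z) = m(z²)/z` below is the reciprocal of the odd square-root transform of
  -- `g`.
  set m : ℂ → ℂ := fun z => exp (-l z / 2) with hm
  have hmd : ∀ z ∈ ball (0 : ℂ) 1, HasDerivAt m (exp (-l z / 2) * (-(deriv φ z / φ z) / 2)) z :=
    fun z hz => ((hld z hz).neg.div_const 2).cexp
  have hm0 : m 0 = 1 := by simp [hm, hl0]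
  have hmφ : ∀ z ∈ ball (0 : ℂ) 1, m z ^ 2 * φ z = 1 := by
    intro z hz
    rw [hlφ z hz, hm]
    simp only
    rw [← exp_nat_mul, ← exp_add]
    convert exp_zero using 2
    push_cast; ring
  have hmD : DifferentiableOn ℂ m (ball 0 1) :=
    fun z hz => (hmd z hz).differentiableAt.differentiableWithinAt
  have hn := differentiableOn_dslope_zero (differentiableOn_dslope_zero hmD)
  set n := dslope (dslope m 0) 0 with hndef
  set b := deriv m 0 with hb
  have hmexp : ∀ z, m z = 1 + b * z + z ^ 2 * n z := by
    intro z
    rw [eq_add_mul_dslope m z, eq_add_mul_dslope (dslope m 0) z, dslope_same, hm0]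
    ring
  have hbval : b = -deriv φ 0 / 2 := by
    rw [hb, (hmd 0 z0).deriv, hl0, hφ0]; simp
  have hsq : ∀ z ∈ ball (0 : ℂ) 1, z ^ 2 ∈ ball (0 : ℂ) 1 := by
    intro z hz
    rw [mem_ball_zero_iff] at hz ⊢
    rw [norm_pow]; exact pow_lt_one₀ (norm_nonneg z) hz two_ne_zero
  set k : ℂ → ℂ := fun z => z * n (z ^ 2) with hk
  set F : ℂ → ℂ := fun z => z⁻¹ + b * z + z ^ 2 * k z with hF
  have hkd : DifferentiableOn ℂ k (ball 0 1) :=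
    differentiableOn_id.mul (hn.comp (differentiableOn_id.pow 2) hsq)
  have hFm : ∀ z, z ≠ 0 → F z = m (z ^ 2) / z := by
    intro z hz
    simp only [hF, hk]
    rw [hmexp]; field_simp
  have hFne : ∀ z ∈ ball (0 : ℂ) 1, z ≠ 0 → F z ≠ 0 := by
    intro z hz hz0
    rw [hFm z hz0]; exact div_ne_zero (exp_ne_zero _) hz0
  have hFg : ∀ z ∈ ball (0 : ℂ) 1, z ≠ 0 → F z ^ 2 * g (z ^ 2) = 1 := by
    intro z hz hz0
    rw [hFm z hz0, hgφ, div_pow, ← hmφ _ (hsq z hz)]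
    field_simp
  have hFinj : InjOn F (ball 0 1 \ {0}) := by
    rintro z ⟨hz, hz0⟩ w ⟨hw, hw0⟩ hzw
    have e1 := hFg z hz hz0
    have e2 := hFg w hw hw0
    rw [hzw, ← e2] at e1
    have e3 := hinj (hsq z hz) (hsq w hw)
      (mul_left_cancel₀ (pow_ne_zero 2 (hFne w hw hw0)) e1)
    -- Injectivity of `g` gives only `z² = w²`; oddness of the nonvanishing `F` excludes `z = -w`.
    rcases sq_eq_sq_iff_eq_or_eq_neg.1 e3 with h | h
    · exact h
    · exfalso
      have hodd : F (-w) = -F w := by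
        simp only [hF, hk, neg_sq, inv_neg]; ring
      rw [h, hodd] at hzw
      exact hFne w hw hw0 (by linear_combination (-1 / 2 : ℂ) * hzw)
  have hble := norm_le_one_of_injOn_inv_add hkd (fun z => rfl) hFne hFinj
  rw [deriv_deriv_eq_two_mul_deriv_dslope hd, ← hφdef]
  have : deriv φ 0 = -2 * b := by rw [hbval]; ring
  rw [this, norm_mul, norm_mul, norm_neg]
  simp only [Complex.norm_ofNat]
  linarith

/-! ### Disk automorphisms -/

/-- The disk automorphism `z ↦ (z + a) / (1 + conj a z)`. -/
noncomputable def mobius (a z : ℂ) : ℂ := (z + a) / (1 + conj a * z)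

theorem one_add_conj_mul_ne_zero {a z : ℂ} (ha : ‖a‖ < 1) (hz : ‖z‖ < 1) :
    1 + conj a * z ≠ 0 := by
  intro h
  have h1 : conj a * z = -1 := by linear_combination h
  have h2 : ‖a‖ * ‖z‖ = 1 := by
    have := congrArg norm h1
    simpa using this
  nlinarith [norm_nonneg a, norm_nonneg z]

theorem norm_mobius_lt_one {a z : ℂ} (ha : ‖a‖ < 1) (hz : ‖z‖ < 1) : ‖mobius a z‖ < 1 := by
  have hden := one_add_conj_mul_ne_zero ha hz
  rw [mobius, norm_div, div_lt_one (norm_pos_iff.2 hden)]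
  refine lt_of_pow_lt_pow_left₀ 2 (norm_nonneg _) ?_
  have key : ‖1 + conj a * z‖ ^ 2 - ‖z + a‖ ^ 2 = (1 - ‖a‖ ^ 2) * (1 - ‖z‖ ^ 2) := by
    simp only [Complex.sq_norm, normSq_apply]
    simp
    ring
  have : 0 < (1 - ‖a‖ ^ 2) * (1 - ‖z‖ ^ 2) :=
    mul_pos (by nlinarith [norm_nonneg a]) (by nlinarith [norm_nonneg z])
  linarith

theorem mapsTo_mobius {a : ℂ} (ha : ‖a‖ < 1) : MapsTo (mobius a) (ball 0 1) (ball 0 1) := by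
  intro z hz
  rw [mem_ball_zero_iff] at hz ⊢
  exact norm_mobius_lt_one ha hz

theorem hasDerivAt_mobius {a z : ℂ} (ha : ‖a‖ < 1) (hz : ‖z‖ < 1) :
    HasDerivAt (mobius a) ((1 - ‖a‖ ^ 2 : ℝ) / (1 + conj a * z) ^ 2) z := by
  have hden := one_add_conj_mul_ne_zero ha hz
  have h := ((hasDerivAt_id z).add_const a).div
    (((hasDerivAt_id z).const_mul (conj a)).const_add 1) hden
  refine h.congr_deriv ?_
  congr 1
  have : a * conj a = (‖a‖ ^ 2 : ℝ) := by rw [mul_conj, Complex.sq_norm]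
  push_cast at this ⊢
  rw [← this]; simp; ring

theorem one_sub_norm_sq_ne_zero {a : ℂ} (ha : ‖a‖ < 1) : ((1 - ‖a‖ ^ 2 : ℝ) : ℂ) ≠ 0 := by
  have : 0 < 1 - ‖a‖ ^ 2 := by nlinarith [norm_nonneg a]
  exact_mod_cast this.ne'

theorem injOn_mobius {a : ℂ} (ha : ‖a‖ < 1) : InjOn (mobius a) (ball 0 1) := by
  intro z hz w hw h
  rw [mem_ball_zero_iff] at hz hw
  rw [mobius, mobius, div_eq_div_iff (one_add_conj_mul_ne_zero ha hz)
    (one_add_conj_mul_ne_zero ha hw)] at h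
  have h1 : a * conj a = (‖a‖ ^ 2 : ℝ) := by rw [mul_conj, Complex.sq_norm]
  have h2 : ((1 - ‖a‖ ^ 2 : ℝ) : ℂ) * (z - w) = 0 := by
    push_cast at h1 ⊢
    rw [← h1]; linear_combination h
  exact sub_eq_zero.1 ((mul_eq_zero.1 h2).resolve_left (one_sub_norm_sq_ne_zero ha))

theorem mobius_zero (a : ℂ) : mobius a 0 = a := by simp [mobius]

/-! ### Distortion of the pre-Schwarzian -/

/-- Koebe's transform of Bieberbach's theorem. -/
theorem norm_one_sub_sq_mul_sub_le {g : ℂ → ℂ} (hd : DifferentiableOn ℂ g (ball 0 1))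
    (hinj : InjOn g (ball 0 1)) {a : ℂ} (ha : ‖a‖ < 1) (hga : deriv g a ≠ 0) :
    ‖(1 - ‖a‖ ^ 2 : ℝ) * (deriv (deriv g) a / deriv g a) - 2 * conj a‖ ≤ 4 := by
  set q : ℂ := ((1 - ‖a‖ ^ 2 : ℝ) : ℂ) with hq
  have hq0 : q ≠ 0 := one_sub_norm_sq_ne_zero ha
  set K : ℂ → ℂ := fun z => (g (mobius a z) - g a) / (q * deriv g a) with hK
  have hKd : ∀ z ∈ ball (0 : ℂ) 1, HasDerivAt K
      (deriv g (mobius a z) * (1 / (1 + conj a * z) ^ 2) / deriv g a) z := by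
    intro z hz
    have hz' := mem_ball_zero_iff.1 hz
    have h1 := (hd.differentiableAt (isOpen_ball.mem_nhds (mapsTo_mobius ha hz))).hasDerivAt
    have h2 := ((h1.comp z (hasDerivAt_mobius ha hz')).sub_const (g a)).div_const (q * deriv g a)
    refine h2.congr_deriv ?_
    rw [← hq]
    have := one_add_conj_mul_ne_zero ha hz'
    field_simp
  have z0 : (0 : ℂ) ∈ ball (0 : ℂ) 1 := mem_ball_self one_pos
  have hKS : K ∈ classS := by
    refine ⟨⟨fun z hz => (hKd z hz).differentiableAt.differentiableWithinAt, ?_, ?_⟩, ?_⟩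
    · simp [hK, mobius_zero]
    · rw [(hKd 0 z0).deriv, mobius_zero]; simp [hga]
    · intro z hz w hw h
      simp only [hK] at h
      have h3 := (div_left_inj' (mul_ne_zero hq0 hga)).1 h
      exact injOn_mobius ha hz hw
        (hinj (mapsTo_mobius ha hz) (mapsTo_mobius ha hw) (by linear_combination h3))
  have hB := norm_deriv_deriv_zero_le_four hKS
  have hev : deriv K =ᶠ[𝓝 0]
      fun z => deriv g (mobius a z) * (1 / (1 + conj a * z) ^ 2) / deriv g a := by
    filter_upwards [ball_mem_nhds (0 : ℂ) one_pos] with z hz using (hKd z hz).deriv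
  have hma : mobius a 0 ∈ ball (0 : ℂ) 1 := mapsTo_mobius ha z0
  have h1 := ((hd.deriv isOpen_ball).differentiableAt (isOpen_ball.mem_nhds hma)).hasDerivAt
  have h2 := h1.comp (0 : ℂ) (hasDerivAt_mobius ha (by simp))
  have h3 : HasDerivAt (fun z : ℂ => 1 / (1 + conj a * z) ^ 2) (-2 * conj a) 0 := by
    have h4 := ((((hasDerivAt_id (0 : ℂ)).const_mul (conj a)).const_add 1).pow 2).inv
      (by simp)
    refine (h4.congr_of_eventuallyEq ?_).congr_deriv ?_
    · exact Eventually.of_forall fun z => by simp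
    · simp
  have h5 := ((h2.mul h3).div_const (deriv g a)).deriv
  rw [hev.deriv_eq] at hB
  refine le_trans (le_of_eq ?_) hB
  refine congrArg norm (Eq.trans ?_ h5.symm)
  simp only [Function.comp_apply, mobius_zero, ← hq]
  simp
  field_simp
  ring

theorem norm_deriv_deriv_div_sub_le {g : ℂ → ℂ} (hd : DifferentiableOn ℂ g (ball 0 1))
    (hinj : InjOn g (ball 0 1)) {a : ℂ} (ha : ‖a‖ < 1) (hga : deriv g a ≠ 0) :
    ‖deriv (deriv g) a / deriv g a - 2 * conj a / (1 - ‖a‖ ^ 2 : ℝ)‖ ≤ 4 / (1 - ‖a‖ ^ 2) := by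
  have h := norm_one_sub_sq_mul_sub_le hd hinj ha hga
  have hp : 0 < 1 - ‖a‖ ^ 2 := by nlinarith [norm_nonneg a]
  have hq0 := one_sub_norm_sq_ne_zero ha
  have e : (1 - ‖a‖ ^ 2 : ℝ) * (deriv (deriv g) a / deriv g a) - 2 * conj a
      = (1 - ‖a‖ ^ 2 : ℝ) *
        (deriv (deriv g) a / deriv g a - 2 * conj a / (1 - ‖a‖ ^ 2 : ℝ)) := by
    rw [mul_sub, mul_div_cancel₀ _ hq0]
  rw [e, norm_mul, norm_real, Real.norm_of_nonneg hp.le] at h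
  rwa [le_div_iff₀' hp]

/-! ### The Schwarz–Pick inequality for derivatives -/

/-- Composing with automorphisms that move `a` and `w a` to 0 reduces this to the Schwarz lemma for
the derivative at 0. -/
theorem norm_deriv_mul_le_one_sub_sq {w : ℂ → ℂ} (hd : DifferentiableOn ℂ w (ball 0 1))
    (hw : MapsTo w (ball 0 1) (ball 0 1)) {a : ℂ} (ha : ‖a‖ < 1) :
    ‖deriv w a‖ * (1 - ‖a‖ ^ 2) ≤ 1 - ‖w a‖ ^ 2 := by
  have hab : a ∈ ball (0 : ℂ) 1 := by simpa using ha
  have hwa : ‖w a‖ < 1 := by simpa using hw hab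
  have hwn : ‖-w a‖ < 1 := by rwa [norm_neg]
  set ψ : ℂ → ℂ := fun z => mobius (-w a) (w (mobius a z)) with hψ
  have hψd : ∀ z ∈ ball (0 : ℂ) 1, HasDerivAt ψ
      ((1 - ‖-w a‖ ^ 2 : ℝ) / (1 + conj (-w a) * w (mobius a z)) ^ 2 *
        (deriv w (mobius a z) * ((1 - ‖a‖ ^ 2 : ℝ) / (1 + conj a * z) ^ 2))) z := by
    intro z hz
    have hz' := mem_ball_zero_iff.1 hz
    have hmz := mapsTo_mobius ha hz
    have h1 := (hd.differentiableAt (isOpen_ball.mem_nhds hmz)).hasDerivAt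
    have h2 := h1.comp z (hasDerivAt_mobius ha hz')
    exact (hasDerivAt_mobius hwn (mem_ball_zero_iff.1 (hw hmz))).comp z h2
  have hψ0 : ψ 0 = 0 := by
    simp [hψ, mobius]
  have z0 : (0 : ℂ) ∈ ball (0 : ℂ) 1 := mem_ball_self one_pos
  have hmaps : MapsTo ψ (ball 0 1) (closedBall (ψ 0) 1) := by
    rw [hψ0]
    exact fun z hz => ball_subset_closedBall (mapsTo_mobius hwn (hw (mapsTo_mobius ha hz)))
  have h3 := norm_deriv_le_one_of_mapsTo_ball
    (fun z hz => (hψd z hz).differentiableAt.differentiableWithinAt) hmaps one_pos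
  have hp : 0 < 1 - ‖w a‖ ^ 2 := by nlinarith [norm_nonneg (w a)]
  have hq : 0 < 1 - ‖a‖ ^ 2 := by nlinarith [norm_nonneg a]
  have hden : (1 + conj (-w a) * w a) = (1 - ‖w a‖ ^ 2 : ℝ) := by
    have h1 : w a * conj (w a) = (‖w a‖ ^ 2 : ℝ) := by rw [mul_conj, Complex.sq_norm]
    push_cast at h1 ⊢
    rw [← h1, map_neg]; ring
  rw [(hψd 0 z0).deriv, mobius_zero, hden, norm_neg] at h3
  simp only [mul_zero, add_zero, one_pow, div_one, norm_mul, norm_div, norm_pow, norm_real,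
    Real.norm_of_nonneg hp.le, Real.norm_of_nonneg hq.le] at h3
  have h4 : (1 - ‖w a‖ ^ 2) / (1 - ‖w a‖ ^ 2) ^ 2 * (‖deriv w a‖ * (1 - ‖a‖ ^ 2))
      = ‖deriv w a‖ * (1 - ‖a‖ ^ 2) / (1 - ‖w a‖ ^ 2) := by
    field_simp
  rw [h4, div_le_one hp] at h3
  exact h3

/-- Schwarz–Pick and `|1+w| ≥ 1-|w|` give the bound `(1+|w|)/(1-|a|²)`; the Schwarz lemma `|w a| ≤
|a|` finishes. -/
theorem norm_deriv_div_one_add_le {w : ℂ → ℂ} (hd : DifferentiableOn ℂ w (ball 0 1))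
    (hw : MapsTo w (ball 0 1) (ball 0 1)) (h0 : w 0 = 0) {a : ℂ} (ha : ‖a‖ < 1) :
    ‖deriv w a / (1 + w a)‖ ≤ 1 / (1 - ‖a‖) := by
  have hab : a ∈ ball (0 : ℂ) 1 := by simpa using ha
  have hwa : ‖w a‖ < 1 := by simpa using hw hab
  have h1 := norm_deriv_mul_le_one_sub_sq hd hw ha
  have h2 : ‖w a‖ ≤ ‖a‖ :=
    norm_le_norm_of_mapsTo_ball hd (hw.mono_right ball_subset_closedBall) h0 ha
  have h3 : 1 - ‖w a‖ ≤ ‖1 + w a‖ := by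
    have := norm_sub_norm_le (1 : ℂ) (-w a)
    rwa [norm_one, norm_neg, sub_neg_eq_add] at this
  have hp : 0 < 1 - ‖w a‖ := by linarith
  have hq : 0 < 1 - ‖a‖ := by linarith
  rw [norm_div, div_le_div_iff₀ (hp.trans_le h3) hq]
  have e : ‖deriv w a‖ * (1 - ‖a‖) * (1 + ‖a‖) ≤ 1 * ‖1 + w a‖ * (1 + ‖a‖) := by
    calc ‖deriv w a‖ * (1 - ‖a‖) * (1 + ‖a‖) = ‖deriv w a‖ * (1 - ‖a‖ ^ 2) := by ring
      _ ≤ 1 - ‖w a‖ ^ 2 := h1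
      _ = (1 - ‖w a‖) * (1 + ‖w a‖) := by ring
      _ ≤ ‖1 + w a‖ * (1 + ‖a‖) := by gcongr
      _ = _ := by ring
  exact le_of_mul_le_mul_right e (by positivity)

/-! ### Functions in the class `ℱ₆` -/

theorem mem_unitDisk {z : ℂ} : z ∈ unitDisk ↔ ‖z‖ < 1 := mem_ball_zero_iff

theorem deriv_ne_zero_of_mem_classF6 {f : ℂ → ℂ} (hf : f ∈ classF6) {z : ℂ} (hz : z ∈ unitDisk) :
    deriv f z ≠ 0 := by
  obtain ⟨-, g, -, h⟩ := hf
  intro h0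
  have := h z hz
  rw [h0] at this
  simp at this

theorem norm_deriv_deriv_div_sub_le_of_mem_classF6 {f : ℂ → ℂ} (hf : f ∈ classF6) {z : ℂ}
    (hz : ‖z‖ < 1) :
    ‖deriv (deriv f) z / deriv f z - 2 * conj z / (1 - ‖z‖ ^ 2 : ℝ)‖
      ≤ (5 + ‖z‖) / (1 - ‖z‖ ^ 2) := by
  have hf' := fun w hw => deriv_ne_zero_of_mem_classF6 (z := w) hf hw
  obtain ⟨⟨hfd, hf0, hf1⟩, g, ⟨⟨hgd, hg0, hg1⟩, hinj⟩, h⟩ := hf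
  -- A zero of `g'` would make the quotient 0 by the division convention, contradicting the strict
  -- inequality.
  have hg' : ∀ w ∈ unitDisk, deriv g w ≠ 0 := by
    intro w hw h0
    have := h w hw
    rw [h0] at this
    simp at this
  set ω : ℂ → ℂ := fun w => deriv f w / deriv g w - 1 with hω
  have hfd' : DifferentiableOn ℂ (deriv f) (ball 0 1) := hfd.deriv isOpen_ball
  have hgd' : DifferentiableOn ℂ (deriv g) (ball 0 1) := hgd.deriv isOpen_ball
  have hωd : DifferentiableOn ℂ ω (ball 0 1) := (hfd'.div hgd' hg').sub_const 1
  have hωm : MapsTo ω (ball 0 1) (ball 0 1) := fun w hw => by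
    rw [mem_ball_zero_iff]; exact h w hw
  have hω0 : ω 0 = 0 := by simp [hω, hf1, hg1]
  have hzm : z ∈ ball (0 : ℂ) 1 := by simpa using hz
  have hb := norm_deriv_div_one_add_le hωd hωm hω0 hz
  have hg2 := norm_deriv_deriv_div_sub_le hgd hinj hz (hg' z hzm)
  have e : deriv ω z / (1 + ω z)
      = deriv (deriv f) z / deriv f z - deriv (deriv g) z / deriv g z := by
    have h1 := (hfd'.differentiableAt (isOpen_ball.mem_nhds hzm)).hasDerivAt
    have h2 := (hgd'.differentiableAt (isOpen_ball.mem_nhds hzm)).hasDerivAt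
    have h3 : deriv ω z = _ := ((h1.div h2 (hg' z hzm)).sub_const 1).deriv
    have n1 := hf' z hzm
    have n2 := hg' z hzm
    rw [h3, show 1 + ω z = deriv f z / deriv g z by simp [hω]]
    field_simp
  rw [e] at hb
  have hsum := norm_add_le_of_le hb hg2
  have hp : 0 < 1 - ‖z‖ := by linarith
  have hp2 : 0 < 1 - ‖z‖ ^ 2 := by nlinarith [norm_nonneg z]
  refine (le_of_eq ?_).trans (hsum.trans (le_of_eq ?_))
  · congr 1; ring
  · have : 1 - ‖z‖ ^ 2 = (1 - ‖z‖) * (1 + ‖z‖) := by ring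
    have hp3 : 0 < 1 + ‖z‖ := by linarith [norm_nonneg z]
    rw [this]
    field_simp
    ring

theorem norm_preSchwarz_sub_le {f : ℂ → ℂ} (hf : f ∈ classF6) {z : ℂ} (hz : ‖z‖ < 1) :
    ‖preSchwarz f z - (2 * ‖z‖ ^ 2 / (1 - ‖z‖ ^ 2) : ℝ)‖
      ≤ (5 * ‖z‖ + ‖z‖ ^ 2) / (1 - ‖z‖ ^ 2) := by
  have h := norm_deriv_deriv_div_sub_le_of_mem_classF6 hf hz
  have h1 : z * conj z = (‖z‖ ^ 2 : ℝ) := by rw [mul_conj, Complex.sq_norm]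
  have e : preSchwarz f z - (2 * ‖z‖ ^ 2 / (1 - ‖z‖ ^ 2) : ℝ)
      = z * (deriv (deriv f) z / deriv f z - 2 * conj z / (1 - ‖z‖ ^ 2 : ℝ)) := by
    rw [preSchwarz, ofReal_div]
    push_cast at h1 ⊢
    rw [← h1]; ring
  rw [e, norm_mul]
  calc ‖z‖ * _ ≤ ‖z‖ * ((5 + ‖z‖) / (1 - ‖z‖ ^ 2)) := by gcongr
    _ = _ := by ring

/-- This is the leftmost point of the disk in `norm_preSchwarz_sub_le`, shifted by 1. -/
theorem le_re_one_add_preSchwarz {f : ℂ → ℂ} (hf : f ∈ classF6) {z : ℂ} (hz : ‖z‖ < 1) :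
    (1 - 5 * ‖z‖) / (1 - ‖z‖ ^ 2) ≤ (1 + preSchwarz f z).re := by
  have h := (abs_re_le_norm _).trans (norm_preSchwarz_sub_le hf hz)
  rw [sub_re, ofReal_re] at h
  have h2 := (abs_le.1 h).1
  have hp2 : 0 < 1 - ‖z‖ ^ 2 := by nlinarith [norm_nonneg z]
  have e : (1 - 5 * ‖z‖) / (1 - ‖z‖ ^ 2) = 1 + 2 * ‖z‖ ^ 2 / (1 - ‖z‖ ^ 2)
      - (5 * ‖z‖ + ‖z‖ ^ 2) / (1 - ‖z‖ ^ 2) := by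
    field_simp; ring
  rw [e, add_re, one_re]
  linarith

/-- A disk with centre `c ∈ [0, 1/2]` on the real axis and radius at most `c + 1/2` lies inside the
parabola `‖w‖ ≤ Re (1 + w)`. -/
theorem norm_le_re_one_add {w : ℂ} {c R : ℝ} (hc : c ≤ 1 / 2) (hR : R ≤ c + 1 / 2)
    (hw : ‖w - c‖ ≤ R) : ‖w‖ ≤ (1 + w).re := by
  have h1 := hw.trans hR
  have h2 : -(1 / 2) ≤ w.re := by
    have := (abs_le.1 ((abs_re_le_norm (w - c)).trans h1)).1
    rw [sub_re, ofReal_re] at this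
    linarith
  have h3 : ‖w - c‖ ^ 2 ≤ (c + 1 / 2) ^ 2 := by gcongr
  rw [Complex.sq_norm, normSq_apply] at h3
  simp only [sub_re, sub_im, ofReal_re, ofReal_im, sub_zero] at h3
  rw [add_re, one_re]
  refine le_of_sq_le_sq ?_ (by linarith)
  rw [Complex.sq_norm, normSq_apply]
  -- With `u = Re w`, the disk bounds `(Im w)²` by `(u+1/2)(2c+1/2-u)`, and the claim `(Im w)² ≤
  -- 2(u+1/2)` follows from `(u+1/2)(u+3/2-2c) ≥ 0`.
  nlinarith [mul_nonneg (show 0 ≤ w.re + 1 / 2 by linarith)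
    (show 0 ≤ w.re + 1 / 2 + (1 - 2 * c) by linarith)]

/-! ### The Noshiro–Warschawski theorem -/

/-- If `f x = f y`, then `Re (f/(y-x))` along the segment has equal end values, although its
derivative `Re f'` is positive. -/
theorem injOn_of_re_deriv_pos {f : ℂ → ℂ} {U : Set ℂ} (hU : IsOpen U) (hconv : Convex ℝ U)
    (hf : DifferentiableOn ℂ f U) (hpos : ∀ z ∈ U, 0 < (deriv f z).re) : InjOn f U := by
  intro x hx y hy hxy
  by_contra hne
  have hd : y - x ≠ 0 := sub_ne_zero.2 (Ne.symm hne)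
  have hmem : ∀ t ∈ Icc (0 : ℝ) 1, x + t * (y - x) ∈ U := by
    intro t ht
    have := hconv.add_smul_sub_mem hx hy ht
    simpa using this
  have hder : ∀ t ∈ Icc (0 : ℝ) 1,
      HasDerivAt (fun t : ℝ => (f (x + t * (y - x)) / (y - x)).re)
        (deriv f (x + t * (y - x))).re t := by
    intro t ht
    have h1 := (hf.differentiableAt (hU.mem_nhds (hmem t ht))).hasDerivAt
    have h2 : HasDerivAt (fun w : ℂ => f (x + w * (y - x)) / (y - x))
        (deriv f (x + t * (y - x))) (t : ℂ) := by
      have h3 : HasDerivAt (fun w : ℂ => x + w * (y - x)) (y - x) (t : ℂ) := by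
        simpa using ((hasDerivAt_id (t : ℂ)).mul_const (y - x)).const_add x
      refine ((h1.comp (t : ℂ) h3).div_const (y - x)).congr_deriv ?_
      field_simp
    exact h2.real_of_complex
  obtain ⟨t, ht, h⟩ := exists_hasDerivAt_eq_slope _ _ (zero_lt_one' ℝ)
    (fun t ht => (hder t ht).continuousAt.continuousWithinAt)
    (fun t ht => hder t (Ioo_subset_Icc_self ht))
  have := hpos _ (hmem t (Ioo_subset_Icc_self ht))
  rw [h] at this
  simp [hxy] at this

/-- For `|z| < 1/5`, `|f''/f'| ≤ (5+3|z|)/(1-|z|²) ≤ 6`, so `|log f'| ≤ 6/5 < π/2` and `Re f' > 0`.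
-/
theorem injOn_of_mem_classF6 {f : ℂ → ℂ} (hf : f ∈ classF6) : InjOn f (ball 0 (1 / 5)) := by
  have hsub : ball (0 : ℂ) (1 / 5) ⊆ ball 0 1 := ball_subset_ball (by norm_num)
  have hfd : DifferentiableOn ℂ f (ball 0 1) := hf.1.1
  obtain ⟨l, hl0, hl, he⟩ := exists_exp_eq_of_ne_zero (r := 1 / 5) (by norm_num)
    ((hfd.deriv isOpen_ball).mono hsub)
    (fun z hz => deriv_ne_zero_of_mem_classF6 hf (hsub hz)) hf.1.2.2
  refine injOn_of_re_deriv_pos isOpen_ball (convex_ball 0 _) (hfd.mono hsub) fun z hz => ?_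
  have hbound : ∀ w ∈ ball (0 : ℂ) (1 / 5), ‖deriv (deriv f) w / deriv f w‖ ≤ 6 := by
    intro w hw
    have hw1 : ‖w‖ < 1 / 5 := mem_ball_zero_iff.1 hw
    have h := norm_deriv_deriv_div_sub_le_of_mem_classF6 hf (z := w) (by linarith)
    have hp : 0 < 1 - ‖w‖ ^ 2 := by nlinarith [norm_nonneg w]
    have h2 : ‖2 * conj w / (1 - ‖w‖ ^ 2 : ℝ)‖ = 2 * ‖w‖ / (1 - ‖w‖ ^ 2) := by
      rw [norm_div, norm_real, Real.norm_of_nonneg hp.le]; simp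
    have h3 := norm_add_le_of_le h h2.le
    rw [sub_add_cancel, ← add_div] at h3
    refine h3.trans ?_
    rw [div_le_iff₀ hp]
    nlinarith [norm_nonneg w]
  have hlz : ‖l z - l 0‖ ≤ 6 * ‖z - 0‖ :=
    (convex_ball (0 : ℂ) (1 / 5)).norm_image_sub_le_of_norm_hasDerivWithin_le
      (fun w hw => (hl w hw).hasDerivWithinAt) hbound (mem_ball_self (by norm_num)) hz
  have hz1 : ‖z‖ < 1 / 5 := mem_ball_zero_iff.1 hz
  rw [hl0, sub_zero, sub_zero] at hlz
  have him := (abs_im_le_norm (l z)).trans hlz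
  rw [he z hz, exp_re]
  refine mul_pos (Real.exp_pos _) (Real.cos_pos_of_mem_Ioo ?_)
  have := Real.pi_gt_three
  have := abs_le.1 him
  constructor <;> linarith

/-! ### Dilations -/

theorem deriv_dilation {r : ℝ} (hr : r ≠ 0) (f : ℂ → ℂ) :
    deriv (dilation r f) = fun z => deriv f (r * z) := by
  have hr' : (r : ℂ) ≠ 0 := by exact_mod_cast hr
  funext z
  have h1 : dilation r f = fun z => (r : ℂ)⁻¹ * f (r * z) := rfl
  rw [h1, deriv_const_mul_field, deriv_comp_mul_left (r : ℂ) f, smul_eq_mul, ← mul_assoc,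
    inv_mul_cancel₀ hr', one_mul]

theorem preSchwarz_dilation {r : ℝ} (hr : r ≠ 0) (f : ℂ → ℂ) (z : ℂ) :
    preSchwarz (dilation r f) z = preSchwarz f (r * z) := by
  rw [preSchwarz, preSchwarz, deriv_dilation hr, deriv_comp_mul_left (r : ℂ) (deriv f), smul_eq_mul]
  ring

theorem norm_mul_lt_of_mem_unitDisk {r : ℝ} (hr : 0 < r) {z : ℂ} (hz : z ∈ unitDisk) :
    ‖(r : ℂ) * z‖ < r := by
  rw [mem_unitDisk] at hz
  rw [norm_mul, norm_real, Real.norm_of_nonneg hr.le]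
  nlinarith

theorem dilation_mem_classS {f : ℂ → ℂ} (hf : f ∈ classF6) {r : ℝ} (hr : 0 < r) (hr5 : r ≤ 1 / 5) :
    dilation r f ∈ classS := by
  have hr' : (r : ℂ) ≠ 0 := by exact_mod_cast hr.ne'
  refine ⟨⟨?_, ?_, ?_⟩, ?_⟩
  · refine DifferentiableOn.const_mul (hf.1.1.comp (by fun_prop) fun z hz => ?_) _
    exact mem_unitDisk.2 ((norm_mul_lt_of_mem_unitDisk hr hz).trans_le (by linarith))
  · simp [dilation, hf.1.2.1]
  · rw [deriv_dilation hr.ne']; simp [hf.1.2.2]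
  · intro z hz w hw h
    have h1 := mul_left_cancel₀ (inv_ne_zero hr') h
    have hm : ∀ z ∈ unitDisk, (r : ℂ) * z ∈ ball (0 : ℂ) (1 / 5) := fun z hz => by
      rw [mem_ball_zero_iff]; exact (norm_mul_lt_of_mem_unitDisk hr hz).trans_le hr5
    exact mul_left_cancel₀ hr' (injOn_of_mem_classF6 hf (hm z hz) (hm w hw) h1)

/-! ### The radii -/

/-- The quadratic is `(1-5R)/(1-R²) = α` cleared of denominators; the rationalized root also covers
`α = 0`. The bound holds since `5R = 1 - α(1-R²)`. -/
theorem convexRadius_spec {α : ℝ} (h0 : 0 ≤ α) (h1 : α < 1) :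
    0 < convexRadius α ∧ convexRadius α ≤ 1 / 5 ∧
      α * convexRadius α ^ 2 - 5 * convexRadius α + (1 - α) = 0 := by
  have hD : 0 ≤ 25 + 4 * α * (α - 1) := by nlinarith
  have hs := Real.sq_sqrt hD
  have hs0 := Real.sqrt_nonneg (25 + 4 * α * (α - 1))
  rw [convexRadius]
  set D := √(25 + 4 * α * (α - 1)) with hDdef
  have hpos : 0 < 5 + D := by linarith
  have e : α * (2 * (1 - α) / (5 + D)) ^ 2 - 5 * (2 * (1 - α) / (5 + D)) + (1 - α) = 0 := by
    field_simp
    linear_combination (1 - α) * hs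
  have hR0 : 0 < 2 * (1 - α) / (5 + D) := div_pos (by linarith) hpos
  have hR1 : 2 * (1 - α) / (5 + D) ≤ 1 := by rw [div_le_one hpos]; linarith
  refine ⟨hR0, ?_, e⟩
  set R := 2 * (1 - α) / (5 + D)
  nlinarith [mul_nonneg h0 (show 0 ≤ 1 - R ^ 2 by nlinarith)]

theorem lt_div_of_lt_convexRadius {α x : ℝ} (h0 : 0 ≤ α) (h1 : α < 1) (hx0 : 0 ≤ x)
    (hx : x < convexRadius α) : α < (1 - 5 * x) / (1 - x ^ 2) := by
  obtain ⟨hR0, hR5, hR⟩ := convexRadius_spec h0 h1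
  set R := convexRadius α
  rw [lt_div_iff₀ (by nlinarith)]
  nlinarith [mul_pos (show 0 < R - x by linarith) (show 0 < 5 - α * (x + R) by nlinarith)]

theorem convexRadius_one_half : convexRadius (1 / 2) = ucvRadius := by
  have h6 : √(25 + 4 * (1 / 2) * (1 / 2 - 1)) = 2 * √6 := by
    rw [show (25 + 4 * (1 / 2) * (1 / 2 - 1) : ℝ) = 2 ^ 2 * 6 by norm_num,
      Real.sqrt_mul (by norm_num), Real.sqrt_sq (by norm_num)]
  rw [convexRadius, ucvRadius, h6, div_eq_iff (by positivity)]
  have := Real.sq_sqrt (show (0 : ℝ) ≤ 6 by norm_num)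
  linear_combination 4 * this

theorem abs_ucvRadius_sub_lt : |ucvRadius - 0.101021| < 0.0000005 := by
  have h1 : (2.44948974 : ℝ) < √6 := Real.lt_sqrt_of_sq_lt (by norm_num)
  have h2 : √6 < 2.44948975 := (Real.sqrt_lt' (by norm_num)).2 (by norm_num)
  rw [ucvRadius, abs_lt]
  constructor <;> norm_num at * <;> linarith

theorem dilation_mem_classC {f : ℂ → ℂ} (hf : f ∈ classF6) {α r : ℝ} (h0 : 0 ≤ α) (h1 : α < 1)
    (hr : 0 < r) (hrα : r ≤ convexRadius α) : dilation r f ∈ classC α := by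
  have hR := convexRadius_spec h0 h1
  refine ⟨dilation_mem_classS hf hr (hrα.trans hR.2.1), fun z hz => ?_⟩
  have hz1 := (norm_mul_lt_of_mem_unitDisk hr hz).trans_le hrα
  rw [preSchwarz_dilation hr.ne']
  exact (lt_div_of_lt_convexRadius h0 h1 (norm_nonneg _) hz1).trans_le
    (le_re_one_add_preSchwarz hf (by linarith))

theorem isRadius_of_extremal {G F : Set (ℂ → ℂ)} {R : ℝ} {f₀ : ℂ → ℂ} (h0 : 0 ≤ R) (h1 : R ≤ 1)
    (hmem : ∀ r, 0 < r → r ≤ R → ∀ f ∈ F, dilation r f ∈ G) (hf₀ : f₀ ∈ F)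
    (hsharp : ∀ r, R < r → r ≤ 1 → dilation r f₀ ∉ G) : IsRadius G F R := by
  refine ⟨⟨h0, h1, hmem⟩, fun S ⟨_, hS1, hS⟩ => ?_⟩
  by_contra! h
  exact hsharp S h hS1 (hS S (h0.trans_lt h) le_rfl f₀ hf₀)

/-! ### Uniformly convex functions -/

theorem hasDerivAt_circleParam (ζ : ℂ) (ρ t : ℝ) :
    HasDerivAt (circleParam ζ ρ) (I * (circleParam ζ ρ t - ζ)) t := by
  have h1 : HasDerivAt (fun t : ℝ => I * (t : ℂ)) I t := by
    simpa using (ofRealCLM.hasDerivAt (x := t)).const_mul I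
  refine ((h1.cexp.const_mul (ρ : ℂ)).const_add ζ).congr_deriv ?_
  rw [circleParam]; ring

theorem continuous_circleParam (ζ : ℂ) (ρ : ℝ) : Continuous (circleParam ζ ρ) :=
  continuous_iff_continuousAt.2 fun t => (hasDerivAt_circleParam ζ ρ t).continuousAt

theorem deriv_comp_circleParam {h : ℂ → ℂ} (hd : DifferentiableOn ℂ h unitDisk) {ζ : ℂ} {ρ t : ℝ}
    (ht : circleParam ζ ρ t ∈ unitDisk) :
    deriv (fun t => h (circleParam ζ ρ t)) t
      = deriv h (circleParam ζ ρ t) * (I * (circleParam ζ ρ t - ζ)) := by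
  have h1 := (hd.differentiableAt (isOpen_ball.mem_nhds ht)).hasDerivAt
  exact (h1.comp t (hasDerivAt_circleParam ζ ρ t)).deriv

/-- If `‖z q‖ ≤ Re (1 + z q)` in the disk, then `Re (1 + (z - ζ) q) ≥ 0` for all `z`, `ζ` in the disk, by
the maximum principle. -/
theorem re_one_add_sub_mul_nonneg {q : ℂ → ℂ} (hq : DifferentiableOn ℂ q (ball 0 1))
    (hle : ∀ z ∈ ball (0 : ℂ) 1, ‖z * q z‖ ≤ (1 + z * q z).re) {z ζ : ℂ} (hz : ‖z‖ < 1)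
    (hζ : ‖ζ‖ < 1) : 0 ≤ (1 + (z - ζ) * q z).re := by
  -- On `|w| = s ≥ |ζ|` the hypothesis dominates `|ζ q(w)|`; the minimum principle, through
  -- `|exp(-·)| ≤ 1`, carries the inequality inside to `z` with `ζ` fixed.
  set s := max ‖z‖ ‖ζ‖ with hs
  have hs1 : s < 1 := max_lt hz hζ
  rcases (le_max_of_le_left (norm_nonneg z) : 0 ≤ s).eq_or_lt with h0 | h0
  · have hz0 : z = 0 := norm_le_zero_iff.1 (h0 ▸ le_max_left _ _)
    have hζ0 : ζ = 0 := norm_le_zero_iff.1 (h0 ▸ le_max_right _ _)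
    simp [hz0, hζ0]
  have hsph : ∀ w ∈ sphere (0 : ℂ) s, 0 ≤ (1 + (w - ζ) * q w).re := by
    intro w hw
    have hwn : ‖w‖ = s := by simpa using hw
    have h1 := hle w (by rw [mem_ball_zero_iff, hwn]; exact hs1)
    have h2 : (1 + (w - ζ) * q w).re = (1 + w * q w).re - (ζ * q w).re := by
      rw [← sub_re]; congr 1; ring
    have h3 := (re_le_norm (ζ * q w))
    rw [norm_mul] at h1 h3
    have h4 : ‖ζ‖ * ‖q w‖ ≤ ‖w‖ * ‖q w‖ := by
      rw [hwn]; gcongr; exact le_max_right _ _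
    linarith
  have hd : DifferentiableOn ℂ (fun w => exp (-(1 + (w - ζ) * q w))) (ball 0 1) := by fun_prop
  have hmax := norm_le_of_forall_mem_frontier_norm_le (U := ball (0 : ℂ) s) (C := 1) isBounded_ball
    ((hd.mono (closedBall_subset_ball hs1)).diffContOnCl_ball subset_rfl)
    (fun w hw => by
      rw [frontier_ball _ h0.ne'] at hw
      rw [norm_exp, Real.exp_le_one_iff, neg_re]
      linarith [hsph w hw])
    (z := z) (by
      rw [closure_ball _ h0.ne', mem_closedBall_zero_iff]; exact le_max_left _ _)
  rw [norm_exp, Real.exp_le_one_iff, neg_re] at hmax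
  linarith

/-- The tangent `h'(z) i (z-ζ)` has argument `t + π/2 + Im log h'(z)`, whose derivative in `t` is
`Re (1 + (z-ζ) h''/h')`. -/
theorem mem_classUCV_of_norm_preSchwarz_le {h : ℂ → ℂ} (hS : h ∈ classS)
    (hne : ∀ z ∈ unitDisk, deriv h z ≠ 0)
    (hle : ∀ z ∈ unitDisk, ‖preSchwarz h z‖ ≤ (1 + preSchwarz h z).re) : h ∈ classUCV := by
  refine ⟨hS, fun ζ hζ ρ a b hρ hab _ hin => ?_⟩
  have hd : DifferentiableOn ℂ h (ball 0 1) := hS.1.1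
  have hd' := hd.deriv isOpen_ball
  obtain ⟨l, -, hl, he⟩ := exists_exp_eq_of_ne_zero one_pos hd' hne hS.1.2.2
  set q : ℂ → ℂ := fun z => deriv (deriv h) z / deriv h z with hq
  have hqd : DifferentiableOn ℂ q (ball 0 1) := (hd'.deriv isOpen_ball).div hd' hne
  have hpq : ∀ z, preSchwarz h z = z * q z := fun z => by rw [preSchwarz, hq]; ring
  simp only [hpq] at hle
  set θ : ℝ → ℝ := fun t => t + π / 2 + (l (circleParam ζ ρ t)).im with hθ
  have hθd : ∀ t ∈ Icc a b, HasDerivAt θ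
      (1 + (circleParam ζ ρ t - ζ) * q (circleParam ζ ρ t)).re t := by
    intro t ht
    have h1 := (hl _ (hin t ht)).comp t (hasDerivAt_circleParam ζ ρ t)
    have h2 := imCLM.hasFDerivAt.comp_hasDerivAt t h1
    refine (((hasDerivAt_id t).add_const (π / 2)).add h2).congr_deriv ?_
    rw [add_re, one_re]
    congr 1
    rw [imCLM_apply, ← mul_assoc, mul_comm _ I, mul_assoc, I_mul_im, mul_comm]
  refine ⟨θ, fun t ht => (hθd t ht).continuousAt.continuousWithinAt, ?_, fun t ht => ?_⟩
  · refine monotoneOn_of_deriv_nonneg (convex_Icc a b)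
      (fun t ht => (hθd t ht).continuousAt.continuousWithinAt)
      (fun t ht => (hθd t (interior_subset ht)).differentiableAt.differentiableWithinAt)
      fun t ht => ?_
    have ht' := interior_subset ht
    rw [(hθd t ht').deriv]
    exact re_one_add_sub_mul_nonneg hqd hle (mem_unitDisk.1 (hin t ht')) (mem_unitDisk.1 hζ)
  · have hdc := deriv_comp_circleParam hd (hin t ht)
    have hρ' : (ρ : ℂ) ≠ 0 := by exact_mod_cast hρ.ne'
    have hsub : circleParam ζ ρ t - ζ = ρ * exp (I * t) := by rw [circleParam]; ring
    rw [hsub] at hdc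
    have hnorm : ‖deriv (fun t => h (circleParam ζ ρ t)) t‖
        = Real.exp (l (circleParam ζ ρ t)).re * ρ := by
      rw [hdc, norm_mul, norm_mul, norm_mul, norm_I, mul_comm I, norm_exp_ofReal_mul_I,
        he _ (hin t ht), norm_exp, norm_real, Real.norm_of_nonneg hρ.le]
      ring
    refine ⟨?_, ?_⟩
    · rw [← norm_pos_iff, hnorm]; positivity
    · rw [hnorm, hdc, he _ (hin t ht)]
      have e1 : I * (θ t : ℂ) = I * t + (π / 2 * I + I * (l (circleParam ζ ρ t)).im) := by
        simp only [hθ]; push_cast; ring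
      have e2 : exp (l (circleParam ζ ρ t))
          = exp ((l (circleParam ζ ρ t)).re) * exp (I * (l (circleParam ζ ρ t)).im) := by
        rw [← exp_add]; congr 1
        conv_lhs => rw [← re_add_im (l (circleParam ζ ρ t))]
        ring
      rw [e1, exp_add, exp_add, exp_pi_div_two_mul_I, e2]
      push_cast
      ring

theorem exists_circleParam_eq {z ζ : ℂ} : ∃ t, circleParam ζ ‖z - ζ‖ t = z := by
  refine ⟨arg (z - ζ), ?_⟩
  rw [circleParam, mul_comm I, norm_mul_exp_arg_mul_I]; ring

/-- The argument `θ` is only continuous, so the tangent `v` is differentiated instead: `Im (v(t)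
conj v(t₀))` vanishes at `t₀`, is nonnegative just after it, and has derivative `|v(t₀)|² Re (1 +
(z-ζ) h''/h')` there. -/
theorem re_one_add_nonneg_of_mem_classUCV {h : ℂ → ℂ} (hh : h ∈ classUCV) {z ζ : ℂ}
    (hz : z ∈ unitDisk) (hζ : ζ ∈ unitDisk) (hne : z ≠ ζ) :
    0 ≤ (1 + (z - ζ) * (deriv (deriv h) z / deriv h z)).re := by
  obtain ⟨hS, harc⟩ := hh
  have hd : DifferentiableOn ℂ h (ball 0 1) := hS.1.1
  have hd' := hd.deriv isOpen_ball
  set ρ := ‖z - ζ‖ with hρ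
  have hρ0 : 0 < ρ := norm_pos_iff.2 (sub_ne_zero.2 hne)
  obtain ⟨t₀, ht₀⟩ : ∃ t, circleParam ζ ρ t = z := exists_circleParam_eq
  have hev : ∀ᶠ t in 𝓝 t₀, circleParam ζ ρ t ∈ unitDisk :=
    (continuous_circleParam ζ ρ).continuousAt.eventually
      (isOpen_ball.mem_nhds (by rw [ht₀]; exact hz))
  obtain ⟨δ, hδ, hball⟩ := Metric.eventually_nhds_iff_ball.1 hev
  set η := min (δ / 2) π with hη
  have hη0 : 0 < η := lt_min (half_pos hδ) Real.pi_pos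
  obtain ⟨θ, hθc, hθm, hθ⟩ := harc ζ hζ ρ t₀ (t₀ + η) hρ0 (by linarith)
    (by linarith [min_le_right (δ / 2) π, Real.pi_pos]) (fun t ht => hball t (by
      rw [mem_ball, Real.dist_eq, abs_lt]
      have := min_le_left (δ / 2) π
      constructor <;> linarith [ht.1, ht.2]))
  set v : ℝ → ℂ := deriv (fun t => h (circleParam ζ ρ t)) with hv
  have hvev : v =ᶠ[𝓝 t₀] fun t => deriv h (circleParam ζ ρ t) * (I * (circleParam ζ ρ t - ζ)) := by
    filter_upwards [hev] with t ht using deriv_comp_circleParam hd ht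
  have hv0 : v t₀ = deriv h z * (I * (z - ζ)) := by rw [hvev.eq_of_nhds, ht₀]
  have hmem0 : t₀ ∈ Icc t₀ (t₀ + η) := ⟨le_rfl, by linarith⟩
  have hvne : v t₀ ≠ 0 := (hθ t₀ hmem0).1
  have hhz : deriv h z ≠ 0 := by
    intro h0; rw [hv0, h0, zero_mul] at hvne; exact hvne rfl
  set q := deriv (deriv h) z / deriv h z with hq
  have hvd : HasDerivAt v (v t₀ * (I * (1 + (z - ζ) * q))) t₀ := by
    have h1 : HasDerivAt (deriv h) (deriv (deriv h) z) (circleParam ζ ρ t₀) := by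
      rw [ht₀]; exact (hd'.differentiableAt (isOpen_ball.mem_nhds hz)).hasDerivAt
    have h2 := hasDerivAt_circleParam ζ ρ t₀
    have h3 := (h1.comp t₀ h2).mul ((h2.sub_const ζ).const_mul I)
    refine (h3.congr_of_eventuallyEq hvev).congr_deriv ?_
    simp only [Function.comp_apply, ht₀]
    rw [hv0, hq]
    field_simp
    ring
  set W : ℝ → ℝ := fun t => (v t * conj (v t₀)).im with hW
  have hWd : HasDerivAt W (‖v t₀‖ ^ 2 * (1 + (z - ζ) * q).re) t₀ := by
    have h1 := imCLM.hasFDerivAt.comp_hasDerivAt t₀ (hvd.mul_const (conj (v t₀)))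
    refine h1.congr_deriv ?_
    have h2 : v t₀ * (I * (1 + (z - ζ) * q)) * conj (v t₀)
        = (‖v t₀‖ ^ 2 : ℝ) * (I * (1 + (z - ζ) * q)) := by
      rw [Complex.sq_norm, ← mul_conj]; ring
    rw [h2, imCLM_apply, im_ofReal_mul, I_mul_im]
  have hW0 : W t₀ = 0 := by
    simp only [hW]; rw [mul_conj, ofReal_im]
  have hIcc : Icc t₀ (t₀ + η) ∈ 𝓝[>] t₀ := Icc_mem_nhdsGT (by linarith)
  have hWnn : ∀ᶠ t in 𝓝[>] t₀, 0 ≤ W t := by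
    have hlim : Tendsto θ (𝓝[>] t₀) (𝓝 (θ t₀)) :=
      (hθc t₀ hmem0).mono_left (le_inf nhdsWithin_le_nhds (le_principal_iff.2 hIcc))
    -- While `θ` has grown by less than `π`, the sine of its increment is nonnegative.
    filter_upwards [hIcc, hlim.eventually_lt_const (show θ t₀ < θ t₀ + π by linarith [Real.pi_pos])]
      with t ht hlt
    have hmono := hθm hmem0 ht ht.1
    have e : v t * conj (v t₀) = (‖v t‖ * ‖v t₀‖ : ℝ) * exp ((θ t - θ t₀ : ℝ) * I) := by
      rw [(hθ t ht).2, (hθ t₀ hmem0).2]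
      simp only [map_mul, conj_ofReal, ← exp_conj, conj_I]
      have : exp ((θ t - θ t₀ : ℝ) * I) = exp (I * θ t) * exp (-I * θ t₀) := by
        rw [← exp_add]; congr 1; push_cast; ring
      rw [this]
      simp [norm_exp]
      ring
    simp only [hW]
    rw [e, im_ofReal_mul, exp_ofReal_mul_I_im]
    exact mul_nonneg (by positivity)
      (Real.sin_nonneg_of_nonneg_of_le_pi (by linarith) (by linarith))
  have hslope : Tendsto (slope W t₀) (𝓝[>] t₀) (𝓝 (‖v t₀‖ ^ 2 * (1 + (z - ζ) * q).re)) :=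
    (hasDerivWithinAt_iff_tendsto_slope' (by simp)).1 (hWd.hasDerivWithinAt (s := Ioi t₀))
  have hge := ge_of_tendsto hslope (by
    filter_upwards [hWnn, self_mem_nhdsWithin] with t ht htt
    rw [slope_def_field, hW0, sub_zero]
    exact div_nonneg ht (sub_nonneg.2 (le_of_lt htt)))
  exact nonneg_of_mul_nonneg_right hge (pow_pos (norm_pos_iff.2 hvne) 2)

/-- For a disk with centre `c ≤ 1/2`, the parabola criterion `R ≤ c + 1/2` says `1 + c - R ≥ 1/2`,
the order-`1/2` condition. -/
theorem dilation_mem_classUCV {f : ℂ → ℂ} (hf : f ∈ classF6) {r : ℝ} (hr : 0 < r)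
    (hru : r ≤ ucvRadius) : dilation r f ∈ classUCV := by
  have hR := convexRadius_spec (α := 1 / 2) (by norm_num) (by norm_num)
  have hr' := hru
  rw [← convexRadius_one_half] at hr'
  refine mem_classUCV_of_norm_preSchwarz_le
    (dilation_mem_classS hf hr (hr'.trans hR.2.1)) (fun z hz => ?_) fun z hz => ?_
  · rw [deriv_dilation hr.ne']
    refine deriv_ne_zero_of_mem_classF6 hf (mem_unitDisk.2 ?_)
    exact (norm_mul_lt_of_mem_unitDisk hr hz).trans_le (by linarith [hR.2.1])
  · have hz1 := norm_mul_lt_of_mem_unitDisk hr hz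
    rw [preSchwarz_dilation hr.ne']
    set x := ‖(r : ℂ) * z‖
    have hx0 : 0 ≤ x := norm_nonneg _
    have hx5 : x < 1 / 5 := by linarith [hR.2.1]
    have hp : 0 < 1 - x ^ 2 := by nlinarith
    have h1 := lt_div_of_lt_convexRadius (α := 1 / 2) (by norm_num) (by norm_num) hx0
      (hz1.trans_le hr')
    refine norm_le_re_one_add ?_ ?_ (norm_preSchwarz_sub_le hf (by linarith))
    · rw [div_le_iff₀ hp]; nlinarith
    · rw [lt_div_iff₀ hp] at h1
      rw [div_add' _ _ _ hp.ne', div_le_div_iff_of_pos_right hp]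
      nlinarith

/-! ### The extremal function -/

/-- The function in `𝒜` with derivative `(1 + z)² / (1 - z)³`. -/
noncomputable def extremal (z : ℂ) : ℂ := 2 / (1 - z) ^ 2 - 4 / (1 - z) - log (1 - z) + 2

theorem one_sub_ne_zero_of_norm_lt {z : ℂ} (hz : ‖z‖ < 1) : 1 - z ≠ 0 := by
  intro h
  rw [← sub_eq_zero.1 h] at hz
  simp at hz

theorem one_add_ne_zero_of_norm_lt {z : ℂ} (hz : ‖z‖ < 1) : 1 + z ≠ 0 := by
  have := one_sub_ne_zero_of_norm_lt (z := -z) (by rwa [norm_neg])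
  rwa [sub_neg_eq_add] at this

theorem hasDerivAt_extremal {z : ℂ} (hz : ‖z‖ < 1) :
    HasDerivAt extremal ((1 + z) ^ 2 / (1 - z) ^ 3) z := by
  have hne := one_sub_ne_zero_of_norm_lt hz
  have h1 : HasDerivAt (fun z : ℂ => 1 - z) (-1) z := (hasDerivAt_id z).const_sub 1
  have hslit : 1 - z ∈ slitPlane := by
    left
    have := (re_le_norm z).trans_lt hz
    simp; linarith
  have h2 := ((((hasDerivAt_const z (2 : ℂ)).div (h1.pow 2) (pow_ne_zero 2 hne)).sub
    ((hasDerivAt_const z (4 : ℂ)).div h1 hne)).sub (h1.clog hslit)).add_const 2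
  refine h2.congr_deriv ?_
  simp only [Pi.pow_apply]
  push_cast
  field_simp
  ring

theorem hasDerivAt_koebe {z : ℂ} (hz : ‖z‖ < 1) :
    HasDerivAt koebe ((1 + z) / (1 - z) ^ 3) z := by
  have hne := one_sub_ne_zero_of_norm_lt hz
  have h1 : HasDerivAt (fun z : ℂ => 1 - z) (-1) z := (hasDerivAt_id z).const_sub 1
  refine ((hasDerivAt_id z).div (h1.pow 2) (pow_ne_zero 2 hne)).congr_deriv ?_
  simp only [Pi.pow_apply, id]
  push_cast
  field_simp
  ring

theorem extremal_mem_classA : extremal ∈ classA := by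
  refine ⟨fun z hz =>
    (hasDerivAt_extremal (mem_unitDisk.1 hz)).differentiableAt.differentiableWithinAt, ?_, ?_⟩
  · norm_num [extremal]
  · rw [(hasDerivAt_extremal (by simp)).deriv]; simp

theorem koebe_mem_classS : koebe ∈ classS := by
  refine ⟨⟨fun z hz =>
    (hasDerivAt_koebe (mem_unitDisk.1 hz)).differentiableAt.differentiableWithinAt, ?_, ?_⟩, ?_⟩
  · simp [koebe]
  · rw [(hasDerivAt_koebe (by simp)).deriv]; simp
  · intro z hz w hw h
    rw [mem_unitDisk] at hz hw
    rw [koebe, koebe, div_eq_div_iff (pow_ne_zero 2 (one_sub_ne_zero_of_norm_lt hz))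
      (pow_ne_zero 2 (one_sub_ne_zero_of_norm_lt hw))] at h
    have h1 : (z - w) * (1 - z * w) = 0 := by linear_combination h
    have h2 : ‖z * w‖ < 1 := by
      rw [norm_mul]; nlinarith [norm_nonneg z, norm_nonneg w]
    exact sub_eq_zero.1 ((mul_eq_zero.1 h1).resolve_right (one_sub_ne_zero_of_norm_lt h2))

theorem norm_deriv_extremal_div_sub_one_lt {z : ℂ} (hz : z ∈ unitDisk) :
    ‖deriv extremal z / deriv koebe z - 1‖ < 1 := by
  rw [mem_unitDisk] at hz
  have h1 := one_sub_ne_zero_of_norm_lt hz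
  have h2 := one_add_ne_zero_of_norm_lt hz
  have e : deriv extremal z / deriv koebe z - 1 = z := by
    rw [(hasDerivAt_extremal hz).deriv, (hasDerivAt_koebe hz).deriv]
    field_simp
    ring
  rwa [e]

theorem extremal_mem_classF6 : extremal ∈ classF6 :=
  ⟨extremal_mem_classA, koebe, koebe_mem_classS, fun _ hz => norm_deriv_extremal_div_sub_one_lt hz⟩

/-- At `z = -x` this yields `1 + z f''/f' = (1-5x)/(1-x²)`, equality in `le_re_one_add_preSchwarz`.
-/
theorem preSchwarz_extremal {z : ℂ} (hz : ‖z‖ < 1) :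
    preSchwarz extremal z = z * (5 + z) / (1 - z ^ 2) := by
  have h1 := one_sub_ne_zero_of_norm_lt hz
  have h2 := one_add_ne_zero_of_norm_lt hz
  have hev : deriv extremal =ᶠ[𝓝 z] fun z => (1 + z) ^ 2 / (1 - z) ^ 3 := by
    filter_upwards [isOpen_ball.mem_nhds (mem_ball_zero_iff.2 hz)] with w hw
    exact (hasDerivAt_extremal (mem_ball_zero_iff.1 hw)).deriv
  have h3 : HasDerivAt (fun z : ℂ => 1 - z) (-1) z := (hasDerivAt_id z).const_sub 1
  have h4 : HasDerivAt (fun z : ℂ => 1 + z) 1 z := (hasDerivAt_id z).const_add 1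
  have h5 := ((h4.pow 2).div (h3.pow 3) (pow_ne_zero 3 h1)).deriv
  have h6 : deriv (fun z : ℂ => (1 + z) ^ 2 / (1 - z) ^ 3) z = _ := h5
  have h7 : 1 - z ^ 2 = (1 - z) * (1 + z) := by ring
  rw [preSchwarz, hev.deriv_eq, h6, (hasDerivAt_extremal hz).deriv, h7]
  simp only [Pi.pow_apply]
  push_cast
  field_simp
  ring

theorem preSchwarz_extremal_neg_convexRadius {α : ℝ} (h0 : 0 ≤ α) (h1 : α < 1) :
    preSchwarz extremal (-(convexRadius α : ℂ)) = ((α - 1 : ℝ) : ℂ) := by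
  obtain ⟨hR0, hR5, hR⟩ := convexRadius_spec h0 h1
  set R := convexRadius α
  have hn : ‖-(R : ℂ)‖ < 1 := by
    rw [norm_neg, norm_real, Real.norm_of_nonneg hR0.le]; linarith
  have hp : (1 - (-(R : ℂ)) ^ 2) ≠ 0 := by
    have : (1 - R ^ 2 : ℝ) ≠ 0 := by nlinarith
    rw [neg_sq]; exact_mod_cast this
  rw [preSchwarz_extremal hn, div_eq_iff hp]
  have hR' : (α : ℂ) * R ^ 2 - 5 * R + (1 - α) = 0 := by exact_mod_cast hR
  push_cast
  linear_combination hR'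

theorem dilation_extremal_notMem_classC {α r : ℝ} (h0 : 0 ≤ α) (h1 : α < 1)
    (hr : convexRadius α < r) : dilation r extremal ∉ classC α := by
  intro h
  have hR0 := (convexRadius_spec h0 h1).1
  have hr0 : 0 < r := hR0.trans hr
  have hr' : (r : ℂ) ≠ 0 := by exact_mod_cast hr0.ne'
  have := h.2 (-((convexRadius α / r : ℝ) : ℂ)) (by
    rw [mem_unitDisk, norm_neg, norm_real, Real.norm_of_nonneg (by positivity), div_lt_one hr0]
    exact hr)
  rw [preSchwarz_dilation hr0.ne'] at this
  have e : (r : ℂ) * -((convexRadius α / r : ℝ) : ℂ) = -(convexRadius α : ℂ) := by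
    push_cast; field_simp
  rw [e, preSchwarz_extremal_neg_convexRadius h0 h1, add_re, one_re, ofReal_re] at this
  linarith

theorem preSchwarz_extremal_neg_ucvRadius :
    preSchwarz extremal (-(ucvRadius : ℂ)) = ((-1 / 2 : ℝ) : ℂ) := by
  rw [← convexRadius_one_half, preSchwarz_extremal_neg_convexRadius (by norm_num) (by norm_num)]
  norm_num

theorem dilation_extremal_notMem_classUCV {r : ℝ} (hr : ucvRadius < r) :
    dilation r extremal ∉ classUCV := by
  intro h
  have hR0 : 0 < ucvRadius := by
    rw [← convexRadius_one_half]; exact (convexRadius_spec (by norm_num) (by norm_num)).1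
  have hr0 : 0 < r := hR0.trans hr
  have hr' : (r : ℂ) ≠ 0 := by exact_mod_cast hr0.ne'
  set x := ucvRadius / r with hx
  have hx0 : 0 < x := div_pos hR0 hr0
  have hx1 : x < 1 := (div_lt_one hr0).2 hr
  -- Since `q(-x) = 1/(2x)`, a centre `ζ = y` makes `1 + (z-ζ)q = (x-y)/(2x)`, which is negative for
  -- any `y` in `(x, 1)`; the midpoint serves.
  set y := (1 + x) / 2 with hy
  have hz : (-(x : ℂ)) ∈ unitDisk := by
    rw [mem_unitDisk, norm_neg, norm_real, Real.norm_of_nonneg hx0.le]; exact hx1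
  have hζ : (y : ℂ) ∈ unitDisk := by
    rw [mem_unitDisk, norm_real, Real.norm_of_nonneg (by rw [hy]; linarith)]; rw [hy]; linarith
  have hne : (-(x : ℂ)) ≠ y := by
    intro h
    have : -x = y := by exact_mod_cast h
    rw [hy] at this; linarith
  have hpre : preSchwarz (dilation r extremal) (-(x : ℂ)) = ((-1 / 2 : ℝ) : ℂ) := by
    rw [preSchwarz_dilation hr0.ne', ← preSchwarz_extremal_neg_ucvRadius, hx]
    congr 1
    push_cast; field_simp
  have hge := re_one_add_nonneg_of_mem_classUCV h hz hζ hne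
  rw [preSchwarz, mul_div_assoc] at hpre
  set q := deriv (deriv (dilation r extremal)) (-(x : ℂ)) / deriv (dilation r extremal) (-(x : ℂ))
  have hxc : (x : ℂ) ≠ 0 := by exact_mod_cast hx0.ne'
  have hq : q = ((1 / (2 * x) : ℝ) : ℂ) := by
    push_cast at hpre ⊢
    field_simp
    linear_combination (-2) * hpre
  have e : 1 + (-(x : ℂ) - y) * q = ((1 + (-x - y) * (1 / (2 * x)) : ℝ) : ℂ) := by
    rw [hq]; push_cast; ring
  rw [e, ofReal_re] at hge
  have e2 : 1 + (-x - y) * (1 / (2 * x)) = (x - y) / (2 * x) := by field_simp; ring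
  rw [e2] at hge
  have : (x - y) / (2 * x) < 0 := div_neg_of_neg_of_pos (by rw [hy]; linarith) (by linarith)
  linarith

end UnivalentRadius

/-! ### Assembly of the theorem -/

open UnivalentRadius in
theorem theorem3p1 :
    (∀ α : ℝ, 0 ≤ α → α < 1 → IsRadius (classC α) classF6 (convexRadius α)) ∧
    IsRadius classUCV classF6 ucvRadius ∧
    IsRadius (classC (1 / 2)) classF6 ucvRadius ∧
    |ucvRadius - 0.101021| < 0.0000005 ∧
    ∃ f₀ ∈ classA,
      (∀ z ∈ unitDisk, deriv f₀ z = (1 + z) ^ 2 / (1 - z) ^ 3) ∧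
      koebe ∈ classS ∧
      (∀ z ∈ unitDisk, ‖deriv f₀ z / deriv koebe z - 1‖ < 1) ∧
      f₀ ∈ classF6 ∧
      (∀ α : ℝ, 0 ≤ α → α < 1 →
        (1 + preSchwarz f₀ (-(convexRadius α : ℂ))).re = α ∧
        ∀ r : ℝ, convexRadius α < r → r ≤ 1 → dilation r f₀ ∉ classC α) ∧
      ‖preSchwarz f₀ (-(ucvRadius : ℂ))‖ = (1 + preSchwarz f₀ (-(ucvRadius : ℂ))).re ∧
      (∀ r : ℝ, ucvRadius < r → r ≤ 1 → dilation r f₀ ∉ classUCV) := by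
  have hC : ∀ α : ℝ, 0 ≤ α → α < 1 → IsRadius (classC α) classF6 (convexRadius α) := by
    intro α h0 h1
    obtain ⟨hR0, hR5, -⟩ := convexRadius_spec h0 h1
    exact isRadius_of_extremal hR0.le (by linarith)
      (fun r hr hrR f hf => dilation_mem_classC hf h0 h1 hr hrR) extremal_mem_classF6
      (fun r hr _ => dilation_extremal_notMem_classC h0 h1 hr)
  have hhalf := convexRadius_spec (α := 1 / 2) (by norm_num) (by norm_num)
  rw [convexRadius_one_half] at hhalf
  refine ⟨hC, ?_, ?_, abs_ucvRadius_sub_lt, extremal, extremal_mem_classA,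
    fun z hz => (hasDerivAt_extremal (mem_unitDisk.1 hz)).deriv, koebe_mem_classS,
    fun z hz => norm_deriv_extremal_div_sub_one_lt hz, extremal_mem_classF6, ?_, ?_,
    fun r hr _ => dilation_extremal_notMem_classUCV hr⟩
  · exact isRadius_of_extremal hhalf.1.le (by linarith [hhalf.2.1])
      (fun r hr hrR f hf => dilation_mem_classUCV hf hr hrR) extremal_mem_classF6
      (fun r hr _ => dilation_extremal_notMem_classUCV hr)
  · rw [← convexRadius_one_half]; exact hC _ (by norm_num) (by norm_num)
  · intro α h0 h1
    refine ⟨?_, fun r hr _ => dilation_extremal_notMem_classC h0 h1 hr⟩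
    rw [preSchwarz_extremal_neg_convexRadius h0 h1, Complex.add_re, Complex.one_re, Complex.ofReal_re]; ring
  · rw [preSchwarz_extremal_neg_ucvRadius, Complex.norm_real, Complex.add_re, Complex.one_re,
      Complex.ofReal_re]; norm_num
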